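/- For a Borel measure $\rho$ on $\mathbb{R}$ that is finite, write $\hat\rho(z)=\int_{\mathbb{R}} e^{ixz}\,\rho(dx)$, $z\in\mathbb{R}$, and let $\lambda$ be Lebesgue measure. For $r>0$ let $\mathcal{B}_r$ be the class of Borel sets $B\subset\mathbb{R}$ with $B\cap(-r,r)=\emptyset$, and let $\mathcal{B}_0=\bigcup_{r>0}\mathcal{B}_r$. Let $\nu:\mathcal{B}_0\to\mathbb{R}$ be such that $\nu|_{\mathcal{B}_r}$ is a finite signed measure for every $r>0$. Its positive part $\nu^+$, negative part $\nu^-$ and total variation $|\nu|$ are the unique measures on $\mathbb{R}$ that do not charge $\{0\}$ and coincide on each $\mathcal{B}_r$ with the positive part, negative part and total variation of $\nu|_{\mathcal{B}_r}$. Such a $\nu$ is a quasi-Lévy type measure if $\int_{\mathbb{R}} (1\wedge x^2)\,|\nu|(dx)<\infty$; integrals with respect to $\nu$ are $\int g\,d\nu=\int g\,d\nu^+-\int g\,d\nu^-$. A probability measure $\mu$ on $\mathbb{R}$ is quasi-infinitely divisible if there are $a,\gamma\in\mathbb{R}$ and a quasi-Lévy type measure $\nu$ such that $$\hat\mu(z)=\exp\left(-\tfrac12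 a z^2+i\gamma z+\int_{\mathbb{R}}\left(e^{ixz}-1-ixz\mathbf{1}_{[-1,1]}(x)\right)\nu(dx)\right)\quad\text{for all } z\in\mathbb{R}.$$ Corollary. Let $\mu$ be a probability measure on $\mathbb{R}$ of the form $$\mu(dx)=\mu_d(dx)+f(x)\,\lambda(dx),$$ where $f:\mathbb{R}\to[0,\infty)$ is Borel measurable and Lebesgue integrable, $\mu_d$ is a (positive) measure concentrated on a lattice $r+h\mathbb{Z}$ for some $r\in\mathbb{R}$ and $h>0$, and $\hat\mu_d(z)\neq 0$ for all $z\in\mathbb{R}$. Let $\mu=\mu_1\ast\mu_2$ with probability measures $\mu_1,\mu_2$ on $\mathbb{R}$. Then $\mu$ is quasi-infinitely divisible if and only if both $\mu_1$ and $\mu_2$ are quasi-infinitely divisible. -/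

import Mathlib

open MeasureTheory

noncomputable section

namespace QuasiID

/-- The Borel subsets of `ℝ` that do not meet `(-r, r)`. -/
def borelAway (r : ℝ) : Set (Set ℝ) :=
  {A | MeasurableSet A ∧ A ∩ Set.Ioo (-r) r = ∅}

/-- The Borel subsets of `ℝ` that are bounded away from zero. -/
def borelAwayFromZero : Set (Set ℝ) :=
  {A | ∃ r : ℝ, 0 < r ∧ A ∈ borelAway r}

/-- A real function on the Borel sets bounded away from zero whose restriction to `borelAway r`
is a finite signed measure for every `r > 0`. The function is extended by the value `0` to the
sets on which it is not defined. -/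
structure SignedAwayFromZero where
  toFun : Set ℝ → ℝ
  eq_zero_of_notMem : ∀ A : Set ℝ, A ∉ borelAwayFromZero → toFun A = 0
  empty : toFun ∅ = 0
  iUnion : ∀ r : ℝ, 0 < r → ∀ A : ℕ → Set ℝ, (∀ n, A n ∈ borelAway r) →
    Pairwise (Function.onFun Disjoint A) → HasSum (fun n => toFun (A n)) (toFun (⋃ n, A n))

/-- The set `{x | r ≤ |x|}`. -/
def outside (r : ℝ) : Set ℝ := (Set.Ioo (-r) r)ᶜ

theorem measurableSet_outside (r : ℝ) : MeasurableSet (outside r) :=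
  measurableSet_Ioo.compl

theorem inter_outside_mem {A : Set ℝ} (hA : MeasurableSet A) (r : ℝ) :
    A ∩ outside r ∈ borelAway r := by
  refine ⟨hA.inter (measurableSet_outside r), ?_⟩
  ext x
  simp only [outside, Set.mem_inter_iff, Set.mem_compl_iff, Set.mem_empty_iff_false, iff_false]
  tauto

theorem subset_outside {A : Set ℝ} {r : ℝ} (hA : A ∈ borelAway r) : A ⊆ outside r := by
  intro x hx hx'
  have : x ∈ A ∩ Set.Ioo (-r) r := ⟨hx, hx'⟩
  rw [hA.2] at this
  exact this

theorem outside_anti {r s : ℝ} (h : r ≤ s) : outside s ⊆ outside r := by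
  intro x hx hx'
  exact hx ⟨by linarith [hx'.1], by linarith [hx'.2]⟩

namespace SignedAwayFromZero

open Classical in
/-- The restriction of `ν` to the Borel subsets of `{x | r ≤ |x|}`, as a finite signed measure
on `ℝ` that does not charge `(-r, r)`. -/
def restr (ν : SignedAwayFromZero) (r : ℝ) (hr : 0 < r) : SignedMeasure ℝ where
  measureOf' A := if MeasurableSet A then ν.toFun (A ∩ outside r) else 0
  empty' := by simp [ν.empty]
  not_measurable' A hA := by simp [hA]
  m_iUnion' A hA hd := by
    have h := ν.iUnion r hr (fun n => A n ∩ outside r) (fun n => inter_outside_mem (hA n) r)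
      (fun i j hij => (hd hij).mono Set.inter_subset_left Set.inter_subset_left)
    simpa only [hA, MeasurableSet.iUnion hA, if_true, Set.iUnion_inter] using h

theorem restr_apply (ν : SignedAwayFromZero) {r : ℝ} (hr : 0 < r) {A : Set ℝ}
    (hA : MeasurableSet A) : ν.restr r hr A = ν.toFun (A ∩ outside r) := by
  classical
  exact if_pos hA

theorem restr_apply_of_mem (ν : SignedAwayFromZero) {r : ℝ} (hr : 0 < r) {A : Set ℝ}
    (hA : A ∈ borelAway r) : ν.restr r hr A = ν.toFun A := by
  rw [ν.restr_apply hr hA.1, Set.inter_eq_left.2 (subset_outside hA)]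

/-- The nonzero `x` with `n ≤ 1 / |x| < n + 1`: a partition of `ℝ \ {0}` into sets that are
bounded away from zero. -/
def annulus (n : ℕ) : Set ℝ := {x | x ≠ 0 ∧ ⌊|x|⁻¹⌋₊ = n}

/-- The positive part of `ν`; see `posPart_zero` and `posPart_apply`. -/
def posPart (ν : SignedAwayFromZero) : Measure ℝ :=
  Measure.sum fun n : ℕ =>
    (ν.restr (1 / ((n : ℝ) + 1)) (by positivity)).toJordanDecomposition.posPart.restrict
      (annulus n)

/-- The negative part of `ν`; see `negPart_zero` and `negPart_apply`. -/
def negPart (ν : SignedAwayFromZero) : Measure ℝ :=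
  Measure.sum fun n : ℕ =>
    (ν.restr (1 / ((n : ℝ) + 1)) (by positivity)).toJordanDecomposition.negPart.restrict
      (annulus n)

/-- The total variation of `ν`; see `totalVariation_zero` and `totalVariation_apply`. -/
def totalVariation (ν : SignedAwayFromZero) : Measure ℝ := ν.posPart + ν.negPart

theorem measurableSet_annulus (n : ℕ) : MeasurableSet (annulus n) := by
  have h : Measurable fun x : ℝ => ⌊|x|⁻¹⌋₊ := Nat.measurable_floor.comp (by fun_prop)
  exact (measurableSet_singleton (0 : ℝ)).compl.inter (h (measurableSet_singleton n))

theorem annulus_subset (n : ℕ) : annulus n ⊆ outside (1 / ((n : ℝ) + 1)) := by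
  rintro x ⟨hx, hn⟩ hx'
  have h0 : 0 < |x| := abs_pos.2 hx
  have h1 : |x|⁻¹ < (n : ℝ) + 1 := by rw [← hn]; exact Nat.lt_floor_add_one _
  have h2 : |x| < 1 / ((n : ℝ) + 1) := abs_lt.2 hx'
  have h3 : (0 : ℝ) < (n : ℝ) + 1 := by positivity
  rw [lt_div_iff₀ h3] at h2
  have h4 : |x| * |x|⁻¹ < |x| * ((n : ℝ) + 1) := mul_lt_mul_of_pos_left h1 h0
  rw [mul_inv_cancel₀ h0.ne'] at h4
  linarith

theorem annulus_disjoint : Pairwise (Function.onFun Disjoint annulus) := by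
  intro i j hij
  refine Set.disjoint_left.2 ?_
  rintro x ⟨_, hi⟩ ⟨_, hj⟩
  exact hij (hi.symm.trans hj)

theorem iUnion_annulus : ⋃ n, annulus n = {0}ᶜ := by
  ext x
  simp [annulus]

/-- The Jordan decompositions of the restrictions are compatible. -/
theorem jordan_restr (ν : SignedAwayFromZero) {r s : ℝ} (hr : 0 < r) (hs : 0 < s) (h : r ≤ s) :
    (ν.restr s hs).toJordanDecomposition.posPart =
        (ν.restr r hr).toJordanDecomposition.posPart.restrict (outside s) ∧
      (ν.restr s hs).toJordanDecomposition.negPart =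
        (ν.restr r hr).toJordanDecomposition.negPart.restrict (outside s) := by
  set J := (ν.restr r hr).toJordanDecomposition with hJ
  let K : JordanDecomposition ℝ :=
    { posPart := J.posPart.restrict (outside s)
      negPart := J.negPart.restrict (outside s)
      posPart_finite := inferInstance
      negPart_finite := inferInstance
      mutuallySingular := (J.mutuallySingular.restrict _).symm.restrict _ |>.symm }
  have hK : ν.restr s hs = K.toSignedMeasure := by
    ext A hA
    have hA' : MeasurableSet (A ∩ outside s) := hA.inter (measurableSet_outside s)
    have h1 := (ν.restr r hr).apply_eq_posPart_real_sub_negPart_real hA'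
    rw [ν.restr_apply hr hA', Set.inter_assoc, Set.inter_eq_left.2 (outside_anti h)] at h1
    rw [ν.restr_apply hs hA, h1, JordanDecomposition.toSignedMeasure,
      Measure.toSignedMeasure_sub_apply hA]
    simp [K, measureReal_restrict_apply hA, hJ]
  rw [SignedMeasure.toJordanDecomposition_eq hK]
  exact ⟨rfl, rfl⟩

theorem sum_annulus_apply (m : ℕ → Measure ℝ) (m' : Measure ℝ) {s : ℝ} {A : Set ℝ} (hs : 0 < s)
    (hA : A ∈ borelAway s) (h : ∀ n, m n (A ∩ annulus n) = m' (A ∩ annulus n)) :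
    Measure.sum (fun n => (m n).restrict (annulus n)) A = m' A := by
  have h0 : A = ⋃ n, A ∩ annulus n := by
    rw [← Set.inter_iUnion, iUnion_annulus, eq_comm, Set.inter_eq_left]
    rintro x hx rfl
    exact subset_outside hA hx ⟨by linarith, hs⟩
  rw [Measure.sum_apply _ hA.1]
  conv_rhs => rw [h0]
  rw [measure_iUnion
    (fun i j hij => (annulus_disjoint hij).mono Set.inter_subset_right Set.inter_subset_right)
    (fun n => hA.1.inter (measurableSet_annulus n))]
  exact tsum_congr fun n => by rw [Measure.restrict_apply hA.1, h n]

theorem jordan_restr_apply (ν : SignedAwayFromZero) {r s : ℝ} (hr : 0 < r) (hs : 0 < s)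
    {A : Set ℝ} (hAr : A ⊆ outside r) (hAs : A ⊆ outside s) (hA : MeasurableSet A) :
    (ν.restr r hr).toJordanDecomposition.posPart A =
        (ν.restr s hs).toJordanDecomposition.posPart A ∧
      (ν.restr r hr).toJordanDecomposition.negPart A =
        (ν.restr s hs).toJordanDecomposition.negPart A := by
  rcases le_total r s with h | h
  · obtain ⟨h1, h2⟩ := ν.jordan_restr hr hs h
    rw [h1, h2, Measure.restrict_apply hA, Measure.restrict_apply hA, Set.inter_eq_left.2 hAs]
    exact ⟨rfl, rfl⟩
  · obtain ⟨h1, h2⟩ := ν.jordan_restr hs hr h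
    rw [h1, h2, Measure.restrict_apply hA, Measure.restrict_apply hA, Set.inter_eq_left.2 hAr]
    exact ⟨rfl, rfl⟩

theorem posPart_zero (ν : SignedAwayFromZero) : ν.posPart {0} = 0 := by
  rw [posPart, Measure.sum_apply _ (measurableSet_singleton _), ENNReal.tsum_eq_zero]
  intro n
  rw [Measure.restrict_apply (measurableSet_singleton _)]
  have : ({0} : Set ℝ) ∩ annulus n = ∅ := by ext x; simp [annulus]
  rw [this, measure_empty]

theorem negPart_zero (ν : SignedAwayFromZero) : ν.negPart {0} = 0 := by
  rw [negPart, Measure.sum_apply _ (measurableSet_singleton _), ENNReal.tsum_eq_zero]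
  intro n
  rw [Measure.restrict_apply (measurableSet_singleton _)]
  have : ({0} : Set ℝ) ∩ annulus n = ∅ := by ext x; simp [annulus]
  rw [this, measure_empty]

theorem totalVariation_zero (ν : SignedAwayFromZero) : ν.totalVariation {0} = 0 := by
  simp [totalVariation, posPart_zero, negPart_zero]

theorem posPart_apply (ν : SignedAwayFromZero) {r : ℝ} (hr : 0 < r) {A : Set ℝ}
    (hA : A ∈ borelAway r) :
    ν.posPart A = (ν.restr r hr).toJordanDecomposition.posPart A :=
  sum_annulus_apply _ _ hr hA fun n => (ν.jordan_restr_apply _ hr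
    (Set.inter_subset_right.trans (annulus_subset n))
    (Set.inter_subset_left.trans (subset_outside hA))
    (hA.1.inter (measurableSet_annulus n))).1

theorem negPart_apply (ν : SignedAwayFromZero) {r : ℝ} (hr : 0 < r) {A : Set ℝ}
    (hA : A ∈ borelAway r) :
    ν.negPart A = (ν.restr r hr).toJordanDecomposition.negPart A :=
  sum_annulus_apply _ _ hr hA fun n => (ν.jordan_restr_apply _ hr
    (Set.inter_subset_right.trans (annulus_subset n))
    (Set.inter_subset_left.trans (subset_outside hA))
    (hA.1.inter (measurableSet_annulus n))).2

theorem totalVariation_apply (ν : SignedAwayFromZero) {r : ℝ} (hr : 0 < r) {A : Set ℝ}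
    (hA : A ∈ borelAway r) : ν.totalVariation A = (ν.restr r hr).totalVariation A := by
  rw [totalVariation, SignedMeasure.totalVariation, Measure.add_apply, Measure.add_apply,
    ν.posPart_apply hr hA, ν.negPart_apply hr hA]

/-- `ν` is a quasi-Lévy type measure if `∫ min(1, x²) |ν|(dx) < ∞`. -/
def IsQuasiLevyType (ν : SignedAwayFromZero) : Prop :=
  ∫⁻ x, ENNReal.ofReal (min 1 (x ^ 2)) ∂ν.totalVariation < ⊤

/-- The integral of `f` with respect to `ν`, for `f` integrable with respect to `|ν|`. -/
def integral (ν : SignedAwayFromZero) (f : ℝ → ℂ) : ℂ :=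
  (∫ x, f x ∂ν.posPart) - ∫ x, f x ∂ν.negPart

end SignedAwayFromZero

/-- The integrand `exp(ixz) - 1 - ixz 1_{[-1,1]}(x)` of the Lévy–Khintchine formula. -/
def levyKernel (z x : ℝ) : ℂ :=
  Complex.exp (Complex.I * x * z) - 1 -
    Complex.I * x * z * (Set.Icc (-1 : ℝ) 1).indicator (fun _ => (1 : ℂ)) x

/-- The characteristic function of `μ` has a Lévy–Khintchine representation with real `a`, `γ`
and a quasi-Lévy type measure `ν`. -/
def IsQuasiInfinitelyDivisible (μ : Measure ℝ) : Prop :=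
  ∃ (a γ : ℝ) (ν : SignedAwayFromZero), ν.IsQuasiLevyType ∧
    ∀ z : ℝ, charFun μ z =
      Complex.exp (-(1 / 2) * a * z ^ 2 + Complex.I * γ * z + ν.integral (levyKernel z))

/-- The lattice `r + hℤ`. -/
def lattice (r h : ℝ) : Set ℝ := Set.range fun k : ℤ => r + h * (k : ℝ)

end QuasiID

end

/-!
A quasi-infinitely divisible measure has a zero-free characteristic function, since the latter is an
exponential. Conversely, a probability measure `μ = md + ma` with `md` on a lattice, `ma` absolutely
continuous and `charFun md` zero-free is quasi-infinitely divisible as soon as `charFun μ` has no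
zero (`isQuasiInfinitelyDivisible_of_ne_zero`). The factors of `μ` inherit this structure
(`exists_factor_decomposition`): since `μ₂` has an atom, a multiple of a translate of `μ₁` is
bounded by `μ`, so that `μ₁` is absolutely continuous off a lattice, and the lattice parts of `μ₁`
and `μ₂` convolve to that of `μ`. As zero-freeness passes to factors, this gives one direction. The
other one is the additivity of Lévy–Khintchine exponents.

The criterion rests on a theorem of Wiener–Lévy type, `exists_charFun_eq_exp`. The function
`charFun md` is a character times a continuous periodic function without zeros, hence
`exp (i (r + k h) z + Λd z)` with `Λd` continuous and periodic. The quotient of `charFun μ` by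
`charFun md` is zero-free and tends to `1` at `±∞`. Once its winding number `n` is compensated by
the factor `exp (n (2i arctan z + iπ))`, it is `exp (Λa z)` with `Λa` vanishing at infinity.
Approximating `Λd`
uniformly by a trigonometric polynomial `t` and `Λa` by a Schwartz function `s` leaves
`exp (Λd + Λa - t - s) = 1 + u`, where `u` is uniformly small and is the Fourier transform of a
complex measure. The logarithmic series for `log (1 + u)` converges in the Banach algebra of complex
measures, because there the spectral radius of `u` is controlled by suprema: `u = v + w` with `v` on
the lattice and `w` absolutely continuous, and

* the `n`-th power of a trigonometric polynomial bounded by `M` has `O(n)` coefficients, each of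
  modulus at most `M ^ n` (`IsTrigPoly.powerBounded`);
* the `n`-th power of a Schwartz function bounded by `M` is the Fourier transform of a function of
  `L¹` norm `O(n² M ^ n)`, by Fourier inversion and two derivatives (`powerBounded_schwartz`);
* both bounds extend to norm limits, since the spectral radius is subadditive
  (`PowerBounded.add`).

Thus `charFun μ` is the exponential of a linear term, a multiple of `2i arctan`, and the Fourier
transform of a complex measure. The function `2i arctan` is the Lévy–Khintchine exponent with the
signed Lévy density `exp (-|x|) / x` (`isQuasiExponent_two_arctan`), and the hermitian symmetry of
`charFun μ` makes the complex measure real up to a constant.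
-/

noncomputable section

namespace QuasiID

open Complex Filter Topology
open scoped NNReal ENNReal

/-! ### Fourier transforms of complex measures -/

/-- `HasFourierRep G φ C` says that `φ` is the Fourier transform of a complex measure on the
measurable subgroup `G` of `ℝ` with total variation at most `C`. The complex measure is encoded by
a positive measure `ρ` on `ℝ × ℂ`, in which a mass `ρ {(x, w)}` stands for the complex mass
`w * ρ {(x, w)}` at the point `x`; this makes convolutions and infinite sums available as operations
on measures. -/
def HasFourierRep (G : AddSubgroup ℝ) (φ : ℝ → ℂ) (C : ℝ≥0) : Prop :=
  MeasurableSet (G : Set ℝ) ∧ ∃ ρ : Measure (ℝ × ℂ), SFinite ρ ∧ (∀ᵐ p ∂ρ, p.1 ∈ G) ∧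
    ∫⁻ p, ‖p.2‖ₑ ∂ρ ≤ C ∧ ∀ z : ℝ, φ z = ∫ p, cexp (z * p.1 * I) * p.2 ∂ρ

theorem norm_cexp_mul_I (z x : ℝ) : ‖cexp (z * x * I)‖ = 1 := by
  rw [← ofReal_mul, norm_exp_ofReal_mul_I]

theorem enorm_cexp_mul (z : ℝ) (p : ℝ × ℂ) : ‖cexp (z * p.1 * I) * p.2‖ₑ = ‖p.2‖ₑ := by
  rw [enorm_mul, ← ofReal_norm, norm_cexp_mul_I]; simp

theorem measurable_cexp_mul (z : ℝ) :
    Measurable fun p : ℝ × ℂ => cexp (z * p.1 * I) * p.2 := by fun_prop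

theorem integrable_cexp_mul {ρ : Measure (ℝ × ℂ)} (h : ∫⁻ p, ‖p.2‖ₑ ∂ρ < ∞) (z : ℝ) :
    Integrable (fun p : ℝ × ℂ => cexp (z * p.1 * I) * p.2) ρ := by
  refine ⟨(measurable_cexp_mul z).aestronglyMeasurable, ?_⟩
  simpa only [HasFiniteIntegral, enorm_cexp_mul] using h

namespace HasFourierRep

variable {G : AddSubgroup ℝ} {φ ψ : ℝ → ℂ} {C D : ℝ≥0}

theorem mono (h : HasFourierRep G φ C) (hCD : C ≤ D) : HasFourierRep G φ D := by
  obtain ⟨hG, ρ, h1, h2, h3, h4⟩ := h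
  exact ⟨hG, ρ, h1, h2, h3.trans (by exact_mod_cast hCD), h4⟩

theorem of_le {H : AddSubgroup ℝ} (h : HasFourierRep G φ C) (hGH : G ≤ H)
    (hH : MeasurableSet (H : Set ℝ)) :
    HasFourierRep H φ C := by
  obtain ⟨hG, ρ, h1, h2, h3, h4⟩ := h
  exact ⟨hH, ρ, h1, h2.mono fun p hp => hGH hp, h3, h4⟩

theorem norm_le (h : HasFourierRep G φ C) (z : ℝ) : ‖φ z‖ ≤ C := by
  obtain ⟨hG, ρ, h1, h2, h3, h4⟩ := h
  have := enorm_integral_le_lintegral_enorm (μ := ρ) fun p : ℝ × ℂ => cexp (z * p.1 * I) * p.2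
  simp only [enorm_cexp_mul] at this
  rw [← h4 z] at this
  exact_mod_cast this.trans h3

theorem continuous (h : HasFourierRep G φ C) : Continuous φ := by
  obtain ⟨hG, ρ, h1, h2, h3, h4⟩ := h
  rw [funext h4]
  have hi : Integrable (fun p : ℝ × ℂ => ‖p.2‖) ρ := by
    refine ⟨by fun_prop, ?_⟩
    simpa [HasFiniteIntegral] using h3.trans_lt ENNReal.coe_lt_top
  refine continuous_of_dominated (fun z => (measurable_cexp_mul z).aestronglyMeasurable)
    (fun z => Eventually.of_forall fun p => ?_) hi (Eventually.of_forall fun p => by fun_prop)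
  rw [norm_mul, norm_cexp_mul_I, one_mul]

theorem add (h : HasFourierRep G φ C) (h' : HasFourierRep G ψ D) :
    HasFourierRep G (fun z => φ z + ψ z) (C + D) := by
  obtain ⟨hG, ρ, h1, h2, h3, h4⟩ := h
  obtain ⟨-, σ, k1, k2, k3, k4⟩ := h'
  refine ⟨hG, ρ + σ, inferInstance, ae_add_measure_iff.2 ⟨h2, k2⟩, ?_, fun z => ?_⟩
  · rw [lintegral_add_measure]
    push_cast
    gcongr
  · rw [integral_add_measure (integrable_cexp_mul (h3.trans_lt ENNReal.coe_lt_top) z)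
      (integrable_cexp_mul (k3.trans_lt ENNReal.coe_lt_top) z), ← h4, ← k4]

theorem hasSum {φ : ℕ → ℝ → ℂ} {C : ℕ → ℝ≥0} {ψ : ℝ → ℂ} (h : ∀ n, HasFourierRep G (φ n) (C n))
    (hC : Summable C) (hψ : ∀ z, HasSum (fun n => φ n z) (ψ z)) :
    HasFourierRep G ψ (∑' n, C n) := by
  have hG := (h 0).1
  replace h := fun n => (h n).2
  choose ρ h1 h2 h3 h4 using h
  have hle : ∫⁻ p, ‖p.2‖ₑ ∂(Measure.sum ρ) ≤ ((∑' n, C n : ℝ≥0) : ℝ≥0∞) := by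
    rw [lintegral_sum_measure, ENNReal.coe_tsum hC]
    exact ENNReal.tsum_le_tsum h3
  refine ⟨hG, Measure.sum ρ, inferInstance, Measure.ae_sum_iff.2 h2, hle, fun z => ?_⟩
  have := hasSum_integral_measure (integrable_cexp_mul (hle.trans_lt ENNReal.coe_lt_top) z)
  refine (hψ z).unique ?_
  simpa only [h4] using this

/-- The product is represented by the convolution in `ℝ × ℂ`, with addition in the first and
multiplication in the second variable. -/
theorem mul (h : HasFourierRep G φ C) (h' : HasFourierRep G ψ D) :
    HasFourierRep G (fun z => φ z * ψ z) (C * D) := by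
  obtain ⟨hG, ρ, h1, h2, h3, h4⟩ := h
  obtain ⟨-, σ, k1, k2, k3, k4⟩ := h'
  have hm : Measurable fun q : (ℝ × ℂ) × (ℝ × ℂ) => (q.1.1 + q.2.1, q.1.2 * q.2.2) := by fun_prop
  refine ⟨hG, (ρ.prod σ).map fun q => (q.1.1 + q.2.1, q.1.2 * q.2.2), inferInstance, ?_, ?_,
    fun z => ?_⟩
  · refine (ae_map_iff hm.aemeasurable (measurable_fst hG)).2 ?_
    filter_upwards [Measure.quasiMeasurePreserving_fst.ae h2,
      Measure.quasiMeasurePreserving_snd.ae k2] with q hq hq' using G.add_mem hq hq'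
  · rw [lintegral_map (by fun_prop) hm]
    simp only [enorm_mul]
    rw [lintegral_prod_mul (f := fun p : ℝ × ℂ => ‖p.2‖ₑ) (g := fun p : ℝ × ℂ => ‖p.2‖ₑ)
      (by fun_prop) (by fun_prop)]
    push_cast
    gcongr
  · rw [integral_map hm.aemeasurable (measurable_cexp_mul z).aestronglyMeasurable]
    simp only [h4, k4]
    rw [← integral_prod_mul]
    congr with q
    push_cast
    rw [mul_add, add_mul, Complex.exp_add]
    ring

theorem const_mul (h : HasFourierRep G φ C) (c : ℂ) :
    HasFourierRep G (fun z => c * φ z) (‖c‖₊ * C) := by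
  obtain ⟨hG, ρ, h1, h2, h3, h4⟩ := h
  have hm : Measurable fun q : ℝ × ℂ => (q.1, c * q.2) := by fun_prop
  refine ⟨hG, ρ.map fun q => (q.1, c * q.2), inferInstance, ?_, ?_, fun z => ?_⟩
  · exact (ae_map_iff hm.aemeasurable (measurable_fst hG)).2 h2
  · rw [lintegral_map (by fun_prop) hm]
    simp only [enorm_mul]
    rw [lintegral_const_mul _ (by fun_prop)]
    push_cast
    gcongr
    rfl
  · rw [integral_map hm.aemeasurable (measurable_cexp_mul z).aestronglyMeasurable]
    simp only [h4]
    rw [← integral_const_mul]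
    congr with q
    ring

theorem neg (h : HasFourierRep G φ C) : HasFourierRep G (fun z => -φ z) C := by
  simpa using h.const_mul (-1)

theorem sub (h : HasFourierRep G φ C) (h' : HasFourierRep G ψ D) :
    HasFourierRep G (fun z => φ z - ψ z) (C + D) := by
  simpa only [sub_eq_add_neg] using h.add h'.neg

theorem zero (hG : MeasurableSet (G : Set ℝ)) : HasFourierRep G (fun _ => 0) 0 :=
  ⟨hG, 0, inferInstance, by simp, by simp, by simp⟩

theorem character (hG : MeasurableSet (G : Set ℝ)) {x : ℝ} (hx : x ∈ G) :
    HasFourierRep G (fun z => cexp (z * x * I)) 1 := by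
  refine ⟨hG, Measure.dirac (x, 1), inferInstance, by simpa [ae_dirac_eq] using hx, ?_, fun z => ?_⟩
  · rw [lintegral_dirac' _ (by fun_prop)]; simp
  · rw [integral_dirac]; simp

theorem one (hG : MeasurableSet (G : Set ℝ)) : HasFourierRep G (fun _ => 1) 1 := by
  simpa using character hG G.zero_mem

theorem pow (h : HasFourierRep G φ C) (n : ℕ) :
    HasFourierRep G (fun z => φ z ^ n) (C ^ n) := by
  induction n with
  | zero => simpa using one h.1
  | succ n ih => simpa only [pow_succ] using ih.mul h

theorem finsetSum {ι : Type*} (hG : MeasurableSet (G : Set ℝ)) (s : Finset ι)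
    {φ : ι → ℝ → ℂ} {C : ι → ℝ≥0}
    (h : ∀ i ∈ s, HasFourierRep G (φ i) (C i)) :
    HasFourierRep G (fun z => ∑ i ∈ s, φ i z) (∑ i ∈ s, C i) := by
  classical
  induction s using Finset.induction_on with
  | empty => simpa using zero hG
  | insert a s ha ih =>
    simp only [Finset.sum_insert ha]
    exact (h a (Finset.mem_insert_self a s)).add
      (ih fun i hi => h i (Finset.mem_insert_of_mem hi))

theorem charFun (hG : MeasurableSet (G : Set ℝ)) {m : Measure ℝ} [IsFiniteMeasure m]
    (hm : ∀ᵐ x ∂m, x ∈ G) :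
    HasFourierRep G (charFun m) (m Set.univ).toNNReal := by
  have hf : Measurable fun x : ℝ => (x, (1 : ℂ)) := by fun_prop
  refine ⟨hG, m.map fun x => (x, 1), inferInstance, ?_, ?_, fun z => ?_⟩
  · exact (ae_map_iff hf.aemeasurable (measurable_fst hG)).2 hm
  · rw [lintegral_map (by fun_prop) hf, ENNReal.coe_toNNReal (measure_ne_top _ _)]; simp
  · rw [integral_map hf.aemeasurable (measurable_cexp_mul z).aestronglyMeasurable,
      charFun_apply_real]
    simp

/-- The measure on `ℝ × ℂ` that represents a density `q` is the image of Lebesgue measure on the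
graph of `q`; the scaling factor `a` accounts for the normalization of Mathlib's Fourier
transform. -/
theorem of_integrable {q : ℝ → ℂ} (hq : Integrable q) (a : ℝ) :
    HasFourierRep ⊤ (fun z => ∫ x : ℝ, cexp (z * (a * x : ℝ) * I) * q x)
      (∫⁻ x, ‖q x‖ₑ).toNNReal := by
  have hf : AEMeasurable (fun x : ℝ => (a * x, q x)) :=
    AEMeasurable.prodMk (by fun_prop) hq.1.aemeasurable
  refine ⟨MeasurableSet.univ, volume.map fun x => (a * x, q x), inferInstance, by simp, ?_,
    fun z => ?_⟩
  · rw [lintegral_map' (by fun_prop) hf, ENNReal.coe_toNNReal hq.2.ne]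
  · rw [integral_map hf (measurable_cexp_mul z).aestronglyMeasurable]

theorem exp_comp (h : HasFourierRep G φ C) :
    ∃ D, HasFourierRep G (fun z => cexp (φ z)) D := by
  have hs : ∀ z, HasSum (fun n : ℕ => (n.factorial : ℂ)⁻¹ * φ z ^ n) (Complex.exp (φ z)) := by
    intro z
    simpa [Complex.exp_eq_exp_ℂ] using NormedSpace.exp_series_hasSum_exp' (𝕂 := ℂ) (φ z)
  refine ⟨_, hasSum (fun n => (h.pow n).const_mul _) ?_ hs⟩
  rw [← NNReal.summable_coe]
  simpa [div_eq_inv_mul] using Real.summable_pow_div_factorial C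

end HasFourierRep

/-! ### Spectral radius bounds and the logarithm -/

/-- `PowerBounded G φ M` says that the total variations of the convolution powers of the complex
measure with Fourier transform `φ` are `O(M ^ n)`, so that its spectral radius is at most `M`. -/
def PowerBounded (G : AddSubgroup ℝ) (φ : ℝ → ℂ) (M : ℝ≥0) : Prop :=
  ∃ K : ℝ≥0, ∀ n : ℕ, HasFourierRep G (fun z => φ z ^ n) (K * M ^ n)

theorem HasFourierRep.powerBounded {G : AddSubgroup ℝ} {φ : ℝ → ℂ} {C : ℝ≥0}
    (h : HasFourierRep G φ C) : PowerBounded G φ C :=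
  ⟨1, fun n => by simpa using h.pow n⟩

namespace PowerBounded

variable {G : AddSubgroup ℝ} {φ ψ : ℝ → ℂ} {M N : ℝ≥0}

theorem of_le {H : AddSubgroup ℝ} (h : PowerBounded G φ M) (hGH : G ≤ H)
    (hH : MeasurableSet (H : Set ℝ)) : PowerBounded H φ M := by
  obtain ⟨K, hK⟩ := h
  exact ⟨K, fun n => (hK n).of_le hGH hH⟩

theorem mono (h : PowerBounded G φ M) (hMN : M ≤ N) : PowerBounded G φ N := by
  obtain ⟨K, hK⟩ := h
  exact ⟨K, fun n => (hK n).mono (by gcongr)⟩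

/-- The spectral radius is subadditive, by the binomial formula. -/
theorem add (h : PowerBounded G φ M) (h' : PowerBounded G ψ N) :
    PowerBounded G (fun z => φ z + ψ z) (M + N) := by
  obtain ⟨K, hK⟩ := h
  obtain ⟨L, hL⟩ := h'
  refine ⟨K * L, fun n => ?_⟩
  have := HasFourierRep.finsetSum (hK 0).1 (Finset.range (n + 1)) fun m _ =>
    ((hK m).mul (hL (n - m))).const_mul (n.choose m)
  convert this using 1
  · ext z
    rw [add_pow]
    exact Finset.sum_congr rfl fun m _ => by ring
  · rw [add_pow, Finset.mul_sum]
    refine Finset.sum_congr rfl fun m _ => ?_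
    simp
    ring

theorem of_poly_growth {A : ℝ≥0} (h : ∀ n : ℕ, HasFourierRep G (fun z => φ z ^ n)
    (A * (n + 1) ^ 2 * M ^ n)) (hMN : M < N) : PowerBounded G φ N := by
  have hN : (0 : ℝ) < N := by exact_mod_cast zero_le.trans_lt hMN
  have hr : (M / N : ℝ) < 1 := (div_lt_one hN).2 (by exact_mod_cast hMN)
  have ht : Tendsto (fun n : ℕ => ((n : ℝ) ^ 2 * (M / N : ℝ) ^ n +
      2 * ((n : ℝ) ^ 1 * (M / N : ℝ) ^ n) + (n : ℝ) ^ 0 * (M / N : ℝ) ^ n))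
      atTop (𝓝 (0 + 2 * 0 + 0)) := by
    have := fun k => tendsto_pow_const_mul_const_pow_of_lt_one k
      (show (0 : ℝ) ≤ M / N by positivity) hr
    exact ((this 2).add ((this 1).const_mul 2)).add (this 0)
  obtain ⟨B, hB⟩ := ht.bddAbove_range
  refine ⟨A * B.toNNReal, fun n => (h n).mono ?_⟩
  have h1 : ((n : ℝ) + 1) ^ 2 * (M / N : ℝ) ^ n ≤ B.toNNReal :=
    (le_trans (by ring_nf; rfl) (hB ⟨n, rfl⟩)).trans (Real.le_coe_toNNReal B)
  rw [div_pow, ← mul_div_assoc, div_le_iff₀ (by positivity)] at h1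
  rw [mul_assoc, mul_assoc]
  refine mul_le_mul_of_nonneg_left ?_ zero_le
  exact_mod_cast h1

/-- The logarithmic series converges in the Banach algebra of complex measures as soon as the
spectral radius is less than one. -/
theorem log_one_add (h : PowerBounded G φ M) (hM : M < 1) (hφ : ∀ z, ‖φ z‖ < 1) :
    ∃ D, HasFourierRep G (fun z => Complex.log (1 + φ z)) D := by
  obtain ⟨K, hK⟩ := h
  refine ⟨_, HasFourierRep.hasSum (C := fun n => K * M ^ n) (fun n => ?_) ?_
    fun z => hasSum_taylorSeries_log (hφ z)⟩
  · have := ((hK n).const_mul ((-1) ^ (n + 1) / n))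
    refine HasFourierRep.mono (by convert this using 2; ring) ?_
    refine mul_le_of_le_one_left zero_le ?_
    rw [← NNReal.coe_le_coe]
    rcases Nat.eq_zero_or_pos n with rfl | hn
    · simp
    · simpa using inv_le_one_of_one_le₀ (by exact_mod_cast hn : (1 : ℝ) ≤ n)
  · exact (NNReal.summable_geometric hM).mul_left K

end PowerBounded

/-! ### Measures on a lattice -/

theorem measurableSet_zmultiples (h : ℝ) :
    MeasurableSet (AddSubgroup.zmultiples h : Set ℝ) :=
  (Set.countable_range _).measurableSet

/-- Trigonometric polynomials with frequencies in `hℤ`. -/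
def IsTrigPoly (h : ℝ) (T : ℝ → ℂ) : Prop :=
  ∃ (d : ℕ) (P : Polynomial ℂ), ∀ z : ℝ,
    T z = cexp (z * (-(d * h) : ℝ) * I) * P.eval (cexp (z * h * I))

namespace IsTrigPoly

variable {h : ℝ} {S T : ℝ → ℂ}

theorem zero : IsTrigPoly h fun _ => 0 := ⟨0, 0, by simp⟩

theorem add (hS : IsTrigPoly h S) (hT : IsTrigPoly h T) : IsTrigPoly h fun z => S z + T z := by
  obtain ⟨d, P, hP⟩ := hS
  obtain ⟨e, Q, hQ⟩ := hT
  refine ⟨d + e, Polynomial.X ^ e * P + Polynomial.X ^ d * Q, fun z => ?_⟩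
  have h1 (m : ℕ) : cexp (z * (-(m * h) : ℝ) * I) * cexp (z * h * I) ^ m = 1 := by
    rw [← Complex.exp_nat_mul, ← Complex.exp_add]
    convert Complex.exp_zero using 2
    push_cast
    ring
  have h2 : cexp (z * (-((d + e : ℕ) * h) : ℝ) * I) =
      cexp (z * (-(d * h) : ℝ) * I) * cexp (z * (-(e * h) : ℝ) * I) := by
    rw [← Complex.exp_add]
    congr 1
    push_cast
    ring
  simp only [hP, hQ, h2, Polynomial.eval_add, Polynomial.eval_mul, Polynomial.eval_pow,
    Polynomial.eval_X]
  linear_combination (-(cexp (z * (-(d * h) : ℝ) * I) * P.eval (cexp (z * h * I)))) * h1 e -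
    (cexp (z * (-(e * h) : ℝ) * I) * Q.eval (cexp (z * h * I))) * h1 d

theorem monomial (c : ℂ) (k : ℤ) : IsTrigPoly h fun z => c * cexp (z * (k * h : ℝ) * I) := by
  refine ⟨k.natAbs, Polynomial.C c * Polynomial.X ^ (k + k.natAbs).toNat, fun z => ?_⟩
  simp only [Polynomial.eval_mul, Polynomial.eval_C, Polynomial.eval_pow, Polynomial.eval_X]
  rw [← Complex.exp_nat_mul, mul_left_comm, ← Complex.exp_add]
  congr 2
  have : (((k + k.natAbs).toNat : ℤ) : ℂ) = ((k + k.natAbs : ℤ) : ℂ) := by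
    rw [Int.toNat_of_nonneg (by omega)]
  rw [Int.cast_add, Int.cast_natCast, Int.cast_natCast] at this
  rw [this]
  push_cast
  ring

theorem finsetSum {ι : Type*} (s : Finset ι) {T : ι → ℝ → ℂ} (hT : ∀ i ∈ s, IsTrigPoly h (T i)) :
    IsTrigPoly h fun z => ∑ i ∈ s, T i z := by
  classical
  induction s using Finset.induction_on with
  | empty => simpa using zero
  | insert a s ha ih =>
    simp only [Finset.sum_insert ha]
    exact (hT a (Finset.mem_insert_self a s)).add
      (ih fun i hi => hT i (Finset.mem_insert_of_mem hi))

end IsTrigPoly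

/-- Cauchy's estimate for the coefficients of a polynomial bounded on the unit circle. -/
theorem norm_coeff_le_of_forall_norm_eq_one {P : Polynomial ℂ} {M : ℝ}
    (hP : ∀ w : ℂ, ‖w‖ = 1 → ‖P.eval w‖ ≤ M) (j : ℕ) : ‖P.coeff j‖ ≤ M := by
  have h1 := norm_iteratedDeriv_le_of_forall_mem_sphere_norm_le (c := 0) (C := M)
    (f := fun w => P.eval w) j one_pos
    (Differentiable.diffContOnCl P.differentiable) (by simpa using hP)
  have h2 : iteratedDeriv j (fun w => P.eval w) 0 = j.factorial * P.coeff j := by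
    have h3 : ∀ (j : ℕ) (Q : Polynomial ℂ), iteratedDeriv j (fun w => Q.eval w) =
        fun w => (Polynomial.derivative^[j] Q).eval w := by
      intro j
      induction j with
      | zero => simp
      | succ j ih =>
        intro Q
        have hd : deriv (fun w => Q.eval w) = fun w => (Polynomial.derivative Q).eval w := by
          ext w
          exact Q.deriv
        rw [iteratedDeriv_succ', hd, ih, Function.iterate_succ_apply]
    simp only [h3, ← Polynomial.coeff_zero_eq_eval_zero, Polynomial.coeff_iterate_derivative]
    simp [Nat.descFactorial_self]
  rw [h2, norm_mul, Complex.norm_natCast, one_pow, div_one] at h1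
  exact le_of_mul_le_mul_left h1 (by exact_mod_cast j.factorial_pos)

theorem HasFourierRep.polynomial_eval {h : ℝ} {P : Polynomial ℂ} {M : ℝ≥0}
    (hP : ∀ w : ℂ, ‖w‖ = 1 → ‖P.eval w‖ ≤ M) :
    HasFourierRep (AddSubgroup.zmultiples h) (fun z => P.eval (cexp (z * h * I)))
      ((P.natDegree + 1) * M) := by
  have hG := measurableSet_zmultiples h
  have hh : h ∈ AddSubgroup.zmultiples h := AddSubgroup.mem_zmultiples h
  have := finsetSum hG (Finset.range (P.natDegree + 1)) fun j _ =>
    (((character hG hh).pow j).const_mul (P.coeff j)).mono (D := M) (by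
      simpa [← NNReal.coe_le_coe] using norm_coeff_le_of_forall_norm_eq_one hP j)
  simpa [Polynomial.eval_eq_sum_range] using this

/-- The `n`-th power of a trigonometric polynomial of degree `d` has at most `2nd + 1` coefficients,
each bounded by the `n`-th power of its supremum. -/
theorem IsTrigPoly.powerBounded {h : ℝ} (hh : h ≠ 0) {T : ℝ → ℂ} (hT : IsTrigPoly h T)
    {M N : ℝ≥0} (hM : ∀ z, ‖T z‖ ≤ M) (hMN : M < N) :
    PowerBounded (AddSubgroup.zmultiples h) T N := by
  obtain ⟨d, P, hP⟩ := hT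
  have hG := measurableSet_zmultiples h
  have hPM : ∀ w : ℂ, ‖w‖ = 1 → ‖P.eval w‖ ≤ M := by
    intro w hw
    have := hM (w.arg / h)
    rw [hP, norm_mul, norm_cexp_mul_I, one_mul] at this
    convert this using 3
    conv_lhs => rw [← norm_mul_exp_arg_mul_I w, hw]
    push_cast
    rw [div_mul_cancel₀ _ (by exact_mod_cast hh)]
    simp
  refine PowerBounded.of_poly_growth (M := M) (A := P.natDegree + 1) (fun n => ?_) hMN
  have h1 : HasFourierRep (AddSubgroup.zmultiples h) _ 1 := HasFourierRep.character hG
    (x := -(d * h)) (neg_mem ⟨d, by simp⟩)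
  have h2 := HasFourierRep.polynomial_eval (h := h) (P := P ^ n) (M := M ^ n) fun w hw => by
    simpa using pow_le_pow_left₀ (norm_nonneg _) (hPM w hw) n
  have h3 := (h1.pow n).mul h2
  simp only [Polynomial.eval_pow, ← mul_pow, ← hP, one_pow, one_mul] at h3
  refine h3.mono ?_
  gcongr
  have : (((P ^ n).natDegree : ℕ) : ℝ≥0) ≤ n * P.natDegree := by
    exact_mod_cast Polynomial.natDegree_pow_le
  calc (((P ^ n).natDegree : ℕ) : ℝ≥0) + 1 ≤ n * P.natDegree + 1 := by gcongr
    _ ≤ (P.natDegree + 1) * (n + 1) ^ 2 := by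
      rw [← NNReal.coe_le_coe]
      push_cast
      have : (0 : ℝ) ≤ n := by positivity
      have : (0 : ℝ) ≤ P.natDegree := by positivity
      nlinarith [mul_nonneg ‹(0 : ℝ) ≤ n› ‹(0 : ℝ) ≤ P.natDegree›,
        mul_nonneg (sq_nonneg (n : ℝ)) ‹(0 : ℝ) ≤ P.natDegree›]

/-- Trigonometric polynomials are dense for the total variation norm: restrict the measure to the
finitely many frequencies `k h` with `|k| ≤ n`. -/
theorem HasFourierRep.exists_isTrigPoly_sub {h : ℝ} (hh : h ≠ 0) {φ : ℝ → ℂ} {C : ℝ≥0}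
    (hφ : HasFourierRep (AddSubgroup.zmultiples h) φ C) {ε : ℝ≥0} (hε : 0 < ε) :
    ∃ T, IsTrigPoly h T ∧ HasFourierRep (AddSubgroup.zmultiples h) (fun z => φ z - T z) ε := by
  obtain ⟨hG, ρ, h1, h2, h3, h4⟩ := hφ
  let A : ℤ → Set (ℝ × ℂ) := fun k => Prod.fst ⁻¹' {(k * h : ℝ)}
  have hA (k) : MeasurableSet (A k) := measurable_fst (measurableSet_singleton _)
  let U : ℕ → Set (ℝ × ℂ) := fun n => ⋃ k ∈ Finset.Icc (-n : ℤ) n, A k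
  have hU (n) : MeasurableSet (U n) := Finset.measurableSet_biUnion _ fun k _ => hA k
  have hd : Pairwise (Function.onFun Disjoint A) := by
    intro i j hij
    refine Set.disjoint_left.2 fun p hp hp' => hij ?_
    have : (i * h : ℝ) = j * h := (Set.mem_singleton_iff.1 hp).symm.trans hp'
    exact_mod_cast mul_right_cancel₀ hh this
  have hfin := h3.trans_lt ENNReal.coe_lt_top
  let m := ρ.withDensity fun p => ‖p.2‖ₑ
  have hm : IsFiniteMeasure m := isFiniteMeasure_withDensity hfin.ne
  have hlim : Tendsto (fun n => m (U n)ᶜ) atTop (𝓝 (m (⋂ n, (U n)ᶜ))) := by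
    refine tendsto_measure_iInter_atTop (fun n => (hU n).compl.nullMeasurableSet) ?_
      ⟨0, measure_ne_top _ _⟩
    intro a b hab
    refine Set.compl_subset_compl.2 (Set.biUnion_subset_biUnion_left ?_)
    intro k hk
    simp only [Finset.coe_Icc, Set.mem_Icc] at hk ⊢
    omega
  have hnull : m (⋂ n, (U n)ᶜ) = 0 := by
    refine withDensity_absolutelyContinuous _ _ ?_
    refine measure_mono_null ?_ (ae_iff.1 h2)
    intro p hp hp'
    obtain ⟨k, hk⟩ := hp'
    refine Set.mem_iInter.1 hp k.natAbs (Set.mem_biUnion (x := k) ?_ ?_)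
    · simp only [Finset.coe_Icc, Set.mem_Icc]
      omega
    · simpa [A] using hk.symm
  rw [hnull] at hlim
  obtain ⟨n, hn⟩ := (hlim.eventually_lt_const (ENNReal.coe_pos.2 hε)).exists
  refine ⟨fun z => ∫ p in U n, cexp (z * p.1 * I) * p.2 ∂ρ, ?_, hG, ρ.restrict (U n)ᶜ,
    inferInstance, ae_restrict_of_ae h2, ?_, fun z => ?_⟩
  · have : (fun z : ℝ => ∫ p in U n, cexp (z * p.1 * I) * p.2 ∂ρ) = fun z : ℝ =>
        ∑ k ∈ Finset.Icc (-n : ℤ) n, (∫ p in A k, p.2 ∂ρ) * cexp (z * (k * h : ℝ) * I) := by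
      ext z
      rw [integral_biUnion_finset _ (fun k _ => hA k) (fun i _ j _ hij => hd hij)
        fun k _ => (integrable_cexp_mul hfin z).integrableOn]
      refine Finset.sum_congr rfl fun k _ => ?_
      rw [← integral_mul_const]
      refine setIntegral_congr_fun (hA k) fun p hp => ?_
      simp only [A, Set.mem_preimage, Set.mem_singleton_iff] at hp
      simp only [hp, mul_comm]
    rw [this]
    exact IsTrigPoly.finsetSum _ fun k _ => IsTrigPoly.monomial _ _
  · rw [← withDensity_apply _ (hU n).compl]
    exact hn.le
  · simp only [h4]
    rw [← integral_add_compl (hU n) (integrable_cexp_mul hfin z)]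
    ring

/-- The spectral radius of a complex measure on a lattice is the supremum of its Fourier
transform. -/
theorem HasFourierRep.powerBounded_of_lattice {h : ℝ} (hh : h ≠ 0) {φ : ℝ → ℂ} {C M N : ℝ≥0}
    (hφ : HasFourierRep (AddSubgroup.zmultiples h) φ C) (hM : ∀ z, ‖φ z‖ ≤ M) (hMN : M < N) :
    PowerBounded (AddSubgroup.zmultiples h) φ N := by
  obtain ⟨ε, hε, hε'⟩ : ∃ ε : ℝ≥0, 0 < ε ∧ M + 3 * ε = N := by
    refine ⟨(N - M) / 3, div_pos (tsub_pos_of_lt hMN) (by norm_num), ?_⟩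
    rw [mul_div_cancel₀ _ (by norm_num), add_tsub_cancel_of_le hMN.le]
  -- The approximant `T` is bounded by `M + ε`, and the error has norm at most `ε`.
  obtain ⟨T, hT, hφT⟩ := hφ.exists_isTrigPoly_sub hh hε
  have hTM : ∀ z, ‖T z‖ ≤ (M + ε : ℝ≥0) := by
    intro z
    have h1 := norm_sub_norm_le (T z) (φ z)
    have h2 := hφT.norm_le z
    rw [norm_sub_rev] at h2
    have h3 := hM z
    push_cast
    linarith
  have := (hT.powerBounded hh hTM (N := M + 2 * ε) (by
    rw [two_mul, ← add_assoc]; exact lt_add_of_pos_right _ hε)).add hφT.powerBounded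
  refine PowerBounded.mono (N := N) (by simpa using this) ?_
  rw [← hε']
  exact le_of_eq (by ring)

open scoped ContDiff SchwartzMap FourierTransform

/-! ### Fourier transforms of integrable functions -/

/-- The Fourier transform of the complex measure with density `q`. -/
def fourierL1 (q : ℝ → ℂ) (z : ℝ) : ℂ := ∫ x : ℝ, cexp (z * x * I) * q x

theorem integrable_cexp_mul_fun {q : ℝ → ℂ} (hq : Integrable q) (z : ℝ) :
    Integrable fun x : ℝ => cexp (z * x * I) * q x := by
  refine hq.bdd_mul (c := 1) (by fun_prop) (Eventually.of_forall fun x => ?_)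
  rw [norm_cexp_mul_I]

theorem hasFourierRep_fourierL1 {q : ℝ → ℂ} (hq : Integrable q) :
    HasFourierRep ⊤ (fourierL1 q) (∫⁻ x, ‖q x‖ₑ).toNNReal := by
  have := HasFourierRep.of_integrable hq 1
  simpa only [one_mul] using! this

/-- The Fourier transform of `f` is at most `(‖f‖₁ + ‖f''‖₁) / (1 + x²)` at `x`, hence integrable,
and `f` is recovered from it by Fourier inversion. -/
theorem hasFourierRep_of_contDiff {f : ℝ → ℂ} (hf : ContDiff ℝ 2 f) (h0 : Integrable f)
    (h1 : Integrable (deriv f)) (h2 : Integrable (deriv (deriv f))) :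
    HasFourierRep ⊤ f (Real.toNNReal (Real.pi * ((∫ x, ‖f x‖) + ∫ x, ‖deriv (deriv f) x‖))) := by
  set A := (∫ x, ‖f x‖) + ∫ x, ‖deriv (deriv f) x‖ with hA
  have hA0 : 0 ≤ A := by positivity
  have hF : ∀ x, ‖𝓕 f x‖ ≤ A * (1 + x ^ 2)⁻¹ := by
    intro x
    have e0 : ‖𝓕 f x‖ ≤ ∫ x, ‖f x‖ :=
      VectorFourier.norm_fourierIntegral_le_integral_norm _ _ _ _ _
    have e2 : ‖𝓕 (deriv (deriv f)) x‖ ≤ ∫ x, ‖deriv (deriv f) x‖ :=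
      VectorFourier.norm_fourierIntegral_le_integral_norm _ _ _ _ _
    have e3 : 𝓕 (deriv (deriv f)) x = (2 * Real.pi * I * x) ^ 2 * 𝓕 f x := by
      have := Real.fourier_iteratedDeriv (f := f) (N := 2) (n := 2) (by exact_mod_cast hf) (by
        intro n hn
        have : n ≤ 2 := by exact_mod_cast hn
        interval_cases n
        · simpa using h0
        · simpa using h1
        · simpa [iteratedDeriv_succ] using h2) le_rfl
      have := congrFun this x
      simpa [iteratedDeriv_succ] using this
    rw [e3] at e2
    simp only [norm_mul, norm_pow, norm_ofNat, norm_real, norm_I, Real.norm_eq_abs,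
      mul_pow, sq_abs] at e2
    have hpi : (1 : ℝ) ≤ 2 ^ 2 * Real.pi ^ 2 := by nlinarith [Real.pi_gt_three]
    rw [← div_eq_mul_inv, le_div_iff₀ (by positivity)]
    have e4 : x ^ 2 * ‖𝓕 f x‖ ≤ 2 ^ 2 * Real.pi ^ 2 * x ^ 2 * ‖𝓕 f x‖ := by
      have : 0 ≤ x ^ 2 * ‖𝓕 f x‖ := by positivity
      nlinarith
    rw [hA]
    linarith
  have hcont : Continuous (𝓕 f) :=
    VectorFourier.fourierIntegral_continuous Real.continuous_fourierChar (by fun_prop) h0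
  have hdom : Integrable fun x : ℝ => A * (1 + x ^ 2)⁻¹ := integrable_inv_one_add_sq.const_mul A
  have hint : Integrable (𝓕 f) := hdom.mono' hcont.aestronglyMeasurable (Eventually.of_forall hF)
  have hinv := hf.continuous.fourierInv_fourier_eq h0 hint
  have h := HasFourierRep.of_integrable hint (2 * Real.pi)
  have heq : (fun z : ℝ => ∫ x : ℝ, cexp (z * (2 * Real.pi * x : ℝ) * I) * 𝓕 f x) = f := by
    ext z
    conv_rhs => rw [← hinv, Real.fourierInv_eq']
    refine integral_congr_ae (Eventually.of_forall fun x => ?_)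
    simp only [smul_eq_mul]
    congr 2
    simp
    ring
  rw [heq] at h
  refine h.mono ?_
  rw [← NNReal.coe_le_coe, Real.coe_toNNReal _ (by positivity)]
  change (∫⁻ x, ‖𝓕 f x‖ₑ).toReal ≤ _
  rw [← integral_norm_eq_lintegral_enorm hint.1, mul_comm, ← integral_univ_inv_one_add_sq,
    ← integral_const_mul]
  exact integral_mono hint.norm hdom hF

/-- The `L¹` norm of the second derivative of `s ^ n` is `O(n² M ^ n)` when `|s| ≤ M`. -/
theorem powerBounded_schwartz (s : 𝓢(ℝ, ℂ)) {M N : ℝ≥0} (hM : ∀ z, ‖s z‖ ≤ M) (hMN : M < N) :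
    PowerBounded ⊤ s N := by
  -- An intermediate bound, which is positive and can be divided by.
  obtain ⟨M', hMM', hM'N⟩ := exists_between hMN
  have hM'0 : (0 : ℝ) < M' := by exact_mod_cast zero_le.trans_lt hMM'
  replace hM : ∀ z, ‖s z‖ ≤ M' := fun z => (hM z).trans (by exact_mod_cast hMM'.le)
  let s₁ := SchwartzMap.derivCLM ℝ ℂ s
  let s₂ := SchwartzMap.derivCLM ℝ ℂ s₁
  have hs₁ : ∀ x, HasDerivAt s (s₁ x) x := fun x => s.differentiableAt.hasDerivAt
  have hs₂ : ∀ x, HasDerivAt s₁ (s₂ x) x := fun x => s₁.differentiableAt.hasDerivAt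
  obtain ⟨B, hB⟩ : ∃ B, ∀ x, ‖s₁ x‖ ≤ B := ⟨_, SchwartzMap.norm_le_seminorm ℝ s₁⟩
  have hB0 : 0 ≤ B := (norm_nonneg _).trans (hB 0)
  have hd (n : ℕ) : deriv (fun x => s x ^ (n + 1)) = fun x => (n + 1 : ℂ) * s x ^ n * s₁ x := by
    ext x
    simpa using! ((hs₁ x).pow (n + 1)).deriv
  have hdd (n : ℕ) : deriv (fun x => (n + 1 : ℂ) * s x ^ n * s₁ x) = fun x =>
      (n + 1 : ℂ) * (n * s x ^ (n - 1) * s₁ x) * s₁ x + (n + 1 : ℂ) * s x ^ n * s₂ x := by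
    ext x
    exact ((((hs₁ x).pow n).const_mul (n + 1 : ℂ)).mul (hs₂ x)).deriv
  have hpow (n : ℕ) (x : ℝ) : ‖s x ^ n‖ ≤ M' ^ n := by
    rw [norm_pow]; exact pow_le_pow_left₀ (norm_nonneg _) (hM x) n
  have hpow' (n : ℕ) (x : ℝ) : ‖(n : ℂ) * s x ^ (n - 1)‖ ≤ n * (M' ^ n / M') := by
    rw [norm_mul, Complex.norm_natCast]
    rcases n with _ | n
    · simp
    · gcongr
      rw [pow_succ, mul_div_cancel_right₀ _ hM'0.ne']
      exact hpow n x
  have hc : Continuous s := s.continuous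
  have hc₁ : Continuous s₁ := s₁.continuous
  have hc₂ : Continuous s₂ := s₂.continuous
  have hn1 (n : ℕ) : ‖(n + 1 : ℂ)‖ = n + 1 := by
    rw [← Nat.cast_succ, Complex.norm_natCast, Nat.cast_succ]
  have b0 (n : ℕ) (x : ℝ) : ‖s x ^ (n + 1)‖ ≤ M' ^ n * ‖s x‖ := by
    rw [pow_succ, norm_mul]
    exact mul_le_mul_of_nonneg_right (hpow n x) (norm_nonneg _)
  have b1 (n : ℕ) (x : ℝ) : ‖(n + 1 : ℂ) * s x ^ n * s₁ x‖ ≤ (n + 1) * M' ^ n * ‖s₁ x‖ := by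
    rw [norm_mul, norm_mul, hn1]
    gcongr
    exact hpow n x
  have b2 (n : ℕ) (x : ℝ) :
      ‖(n + 1 : ℂ) * (n * s x ^ (n - 1) * s₁ x) * s₁ x + (n + 1 : ℂ) * s x ^ n * s₂ x‖ ≤
        (n + 1) ^ 2 * M' ^ n * (B / M' * ‖s₁ x‖ + ‖s₂ x‖) := by
    refine (norm_add_le _ _).trans ?_
    rw [norm_mul, norm_mul (n + 1 : ℂ), norm_mul _ (s₁ x), norm_mul _ (s₂ x),
      norm_mul (n + 1 : ℂ), hn1]
    have e1 : (n + 1 : ℝ) * (‖(n : ℂ) * s x ^ (n - 1)‖ * ‖s₁ x‖) * ‖s₁ x‖ ≤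
        (n + 1) * ((n + 1) * (M' ^ n / M') * B) * ‖s₁ x‖ := by
      gcongr
      · exact (hpow' n x).trans (by gcongr; linarith)
      · exact hB x
    have e2 : (n + 1 : ℝ) * ‖s x ^ n‖ * ‖s₂ x‖ ≤ (n + 1) ^ 2 * M' ^ n * ‖s₂ x‖ := by
      gcongr
      · nlinarith [(Nat.cast_nonneg n : (0 : ℝ) ≤ n)]
      · exact hpow n x
    calc _ ≤ _ := add_le_add e1 e2
      _ = _ := by ring
  have i0 : Integrable fun x => ‖s x‖ := s.integrable.norm
  have i1 : Integrable fun x => ‖s₁ x‖ := s₁.integrable.norm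
  have i2 : Integrable fun x => B / M' * ‖s₁ x‖ + ‖s₂ x‖ :=
    (i1.const_mul _).add s₂.integrable.norm
  set L₀ := ∫ x, ‖s x‖
  set L₂ := ∫ x, (B / M' * ‖s₁ x‖ + ‖s₂ x‖)
  have hL₀ : 0 ≤ L₀ := integral_nonneg fun x => norm_nonneg _
  have hL₂ : 0 ≤ L₂ := integral_nonneg fun x => by positivity
  refine PowerBounded.of_poly_growth (M := M') (A := 1 + Real.toNNReal (Real.pi * (L₀ + L₂) / M'))
    (fun n => ?_) hM'N
  rcases n with _ | n
  · simpa using (HasFourierRep.one MeasurableSet.univ).mono (by simp)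
  have j0 : Integrable fun x => s x ^ (n + 1) :=
    (i0.const_mul (M' ^ n : ℝ)).mono' (by fun_prop) (Eventually.of_forall (b0 n))
  have j1 : Integrable fun x => (n + 1 : ℂ) * s x ^ n * s₁ x :=
    (i1.const_mul ((n + 1) * M' ^ n : ℝ)).mono' (by fun_prop) (Eventually.of_forall (b1 n))
  have j2 : Integrable fun x => (n + 1 : ℂ) * (n * s x ^ (n - 1) * s₁ x) * s₁ x +
      (n + 1 : ℂ) * s x ^ n * s₂ x :=
    (i2.const_mul ((n + 1) ^ 2 * M' ^ n : ℝ)).mono' (by fun_prop) (Eventually.of_forall (b2 n))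
  have := hasFourierRep_of_contDiff ((s.smooth 2).pow (n + 1)) j0 (by rw [hd]; exact j1)
    (by rw [hd, hdd]; exact j2)
  refine this.mono ?_
  rw [hd, hdd, ← NNReal.coe_le_coe, Real.coe_toNNReal _ (by positivity)]
  have k0 : ∫ x, ‖s x ^ (n + 1)‖ ≤ M' ^ n * L₀ := by
    rw [← integral_const_mul]
    exact integral_mono j0.norm (i0.const_mul _) (b0 n)
  have k2 := integral_mono j2.norm (i2.const_mul _) (b2 n)
  rw [integral_const_mul] at k2
  have hp := Real.pi_pos
  calc _ ≤ Real.pi * ((n + 1) ^ 2 * M' ^ n * L₀ + (n + 1) ^ 2 * M' ^ n * L₂) := by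
        gcongr
        refine k0.trans ?_
        have : (1 : ℝ) ≤ (n + 1) ^ 2 :=
          one_le_pow₀ (by linarith [(Nat.cast_nonneg n : (0 : ℝ) ≤ n)])
        gcongr
        exact le_mul_of_one_le_left (by positivity) this
    _ = (Real.pi * (L₀ + L₂) / M') * (n + 1) ^ 2 * M' ^ (n + 1) := by field_simp; ring
    _ ≤ _ := by
        push_cast
        rw [Real.coe_toNNReal _ (by positivity)]
        gcongr
        · linarith
        · linarith

theorem schwartz_fourier_eq_fourierL1 (g : 𝓢(ℝ, ℂ)) (z : ℝ) :
    𝓕 g (-(2 * Real.pi)⁻¹ * z) = fourierL1 g z := by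
  rw [SchwartzMap.fourier_coe, Real.fourier_eq', fourierL1]
  refine integral_congr_ae (Eventually.of_forall fun x => ?_)
  simp only [smul_eq_mul]
  congr 2
  have : (Real.pi : ℂ) ≠ 0 := by exact_mod_cast Real.pi_ne_zero
  simp
  field_simp

/-- The dilation of a Schwartz function. -/
def schwartzDilate {c : ℝ} (hc : c ≠ 0) (s : 𝓢(ℝ, ℂ)) : 𝓢(ℝ, ℂ) :=
  SchwartzMap.compCLMOfContinuousLinearEquiv ℂ (ContinuousLinearEquiv.smulLeft (Units.mk0 c hc)) s

theorem schwartzDilate_apply {c : ℝ} (hc : c ≠ 0) (s : 𝓢(ℝ, ℂ)) (z : ℝ) :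
    schwartzDilate hc s z = s (c * z) := rfl

/-- Fourier transforms of integrable functions are approximated by Schwartz functions for the total
variation norm, by the density of smooth compactly supported functions in `L¹`. -/
theorem exists_schwartz_sub_fourierL1 {q : ℝ → ℂ} (hq : Integrable q) {ε : ℝ≥0} (hε : 0 < ε) :
    ∃ s : 𝓢(ℝ, ℂ), HasFourierRep ⊤ (fun z => fourierL1 q z - s z) ε := by
  obtain ⟨g, hg1, hg2, hg3⟩ := (memLp_one_iff_integrable.2 hq).exist_eLpNorm_sub_le
    ENNReal.one_ne_top le_rfl (ε := ε) hε
  have hgi : Integrable g := hg2.continuous.integrable_of_hasCompactSupport hg1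
  have hc : (-(2 * Real.pi)⁻¹ : ℝ) ≠ 0 := by simp [Real.pi_ne_zero]
  let s : 𝓢(ℝ, ℂ) := schwartzDilate hc (𝓕 (hg1.toSchwartzMap hg2))
  have hs : ∀ z, s z = fourierL1 g z := schwartz_fourier_eq_fourierL1 _
  refine ⟨s, ?_⟩
  have := hasFourierRep_fourierL1 (hq.sub hgi)
  refine HasFourierRep.mono (C := (∫⁻ x, ‖(q - g) x‖ₑ).toNNReal) ?_ ?_
  · convert this using 2 with z
    rw [hs, fourierL1, fourierL1, fourierL1, ← integral_sub (integrable_cexp_mul_fun hq z)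
      (integrable_cexp_mul_fun hgi z)]
    simp [mul_sub]
  · rw [eLpNorm_one_eq_lintegral_enorm, ENNReal.ofReal_coe_nnreal] at hg3
    simpa using ENNReal.toNNReal_mono ENNReal.coe_ne_top hg3

/-- The spectral radius of an absolutely continuous complex measure is the supremum of its Fourier
transform. -/
theorem powerBounded_fourierL1 {q : ℝ → ℂ} (hq : Integrable q) {M N : ℝ≥0}
    (hM : ∀ z, ‖fourierL1 q z‖ ≤ M) (hMN : M < N) : PowerBounded ⊤ (fourierL1 q) N := by
  obtain ⟨ε, hε, hε'⟩ : ∃ ε : ℝ≥0, 0 < ε ∧ M + 3 * ε = N := by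
    refine ⟨(N - M) / 3, div_pos (tsub_pos_of_lt hMN) (by norm_num), ?_⟩
    rw [mul_div_cancel₀ _ (by norm_num), add_tsub_cancel_of_le hMN.le]
  obtain ⟨T, hφT⟩ := exists_schwartz_sub_fourierL1 hq hε
  have hTM : ∀ z, ‖T z‖ ≤ (M + ε : ℝ≥0) := by
    intro z
    have h1 := norm_sub_norm_le (T z) (fourierL1 q z)
    have h2 := hφT.norm_le z
    rw [norm_sub_rev] at h2
    have h3 := hM z
    push_cast
    linarith
  have := (powerBounded_schwartz T hTM (N := M + 2 * ε) (by
    rw [two_mul, ← add_assoc]; exact lt_add_of_pos_right _ hε)).add hφT.powerBounded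
  refine PowerBounded.mono (N := N) (by simpa using! this) ?_
  rw [← hε']
  exact le_of_eq (by ring)

/-- `IsFourierL1 φ` says that `φ` is the Fourier transform of an integrable function. These
functions form an ideal in the algebra of Fourier transforms of complex measures. -/
def IsFourierL1 (φ : ℝ → ℂ) : Prop := ∃ q : ℝ → ℂ, Integrable q ∧ φ = fourierL1 q

namespace IsFourierL1

variable {φ ψ : ℝ → ℂ}

theorem hasFourierRep (h : IsFourierL1 φ) : ∃ C, HasFourierRep ⊤ φ C := by
  obtain ⟨q, hq, rfl⟩ := h
  exact ⟨_, hasFourierRep_fourierL1 hq⟩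

theorem powerBounded (h : IsFourierL1 φ) {M N : ℝ≥0} (hM : ∀ z, ‖φ z‖ ≤ M) (hMN : M < N) :
    PowerBounded ⊤ φ N := by
  obtain ⟨q, hq, rfl⟩ := h
  exact powerBounded_fourierL1 hq hM hMN

theorem add (h : IsFourierL1 φ) (h' : IsFourierL1 ψ) : IsFourierL1 fun z => φ z + ψ z := by
  obtain ⟨q, hq, rfl⟩ := h
  obtain ⟨p, hp, rfl⟩ := h'
  refine ⟨fun x => q x + p x, hq.add hp, funext fun z => ?_⟩
  rw [fourierL1, fourierL1, fourierL1, ← integral_add (integrable_cexp_mul_fun hq z)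
    (integrable_cexp_mul_fun hp z)]
  simp [mul_add]

theorem comp_neg (h : IsFourierL1 φ) : IsFourierL1 fun z => φ (-z) := by
  obtain ⟨q, hq, rfl⟩ := h
  refine ⟨fun x => q (-x), hq.comp_neg, funext fun z => ?_⟩
  rw [fourierL1, fourierL1, ← integral_neg_eq_self]
  simp

/-- The ideal property: the convolution of a complex measure with an integrable function is an
integrable function. -/
theorem mul (h : IsFourierL1 φ) {C : ℝ≥0} (h' : HasFourierRep ⊤ ψ C) :
    IsFourierL1 fun z => φ z * ψ z := by
  obtain ⟨q, hq, rfl⟩ := h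
  obtain ⟨-, ρ, h1, -, h3, h4⟩ := h'
  have hw : Integrable (fun p : ℝ × ℂ => p.2) ρ := by
    refine ⟨by fun_prop, h3.trans_lt ENNReal.coe_lt_top⟩
  have hmp : MeasurePreserving (fun r : (ℝ × ℂ) × ℝ => (r.1, r.2 - r.1.1)) (ρ.prod volume)
      (ρ.prod volume) :=
    (MeasurePreserving.id ρ).skew_product (g := fun p x => x - p.1) (by fun_prop)
      (Eventually.of_forall fun p => (measurePreserving_sub_right volume p.1).map_eq)
  have hint : Integrable (fun r : (ℝ × ℂ) × ℝ => r.1.2 * q (r.2 - r.1.1)) (ρ.prod volume) :=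
    hmp.integrable_comp_of_integrable (hw.mul_prod hq)
  refine ⟨fun y => ∫ p, p.2 * q (y - p.1) ∂ρ, hint.integral_prod_right, funext fun z => ?_⟩
  have hint' : Integrable (Function.uncurry fun (p : ℝ × ℂ) (y : ℝ) =>
      cexp (z * y * I) * (p.2 * q (y - p.1))) (ρ.prod volume) := by
    refine hint.bdd_mul (c := 1) (by fun_prop) (Eventually.of_forall fun x => ?_)
    rw [norm_cexp_mul_I]
  simp only [h4, fourierL1]
  simp_rw [← integral_const_mul]
  rw [← integral_integral_swap hint']
  refine integral_congr_ae (Eventually.of_forall fun p => ?_)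
  simp only
  rw [← integral_mul_const, ← integral_sub_right_eq_self _ p.1]
  refine integral_congr_ae (Eventually.of_forall fun y => ?_)
  simp only
  rw [show cexp (z * y * I) = cexp (z * (y - p.1 : ℝ) * I) * cexp (z * p.1 * I) by
    rw [← Complex.exp_add]; congr 1; push_cast; ring]
  ring

theorem const_mul (h : IsFourierL1 φ) (c : ℂ) : IsFourierL1 fun z => c * φ z := by
  obtain ⟨q, hq, rfl⟩ := h
  refine ⟨fun x => c * q x, hq.const_mul c, funext fun z => ?_⟩
  rw [fourierL1, fourierL1, ← integral_const_mul]
  exact integral_congr_ae (Eventually.of_forall fun x => by ring)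

theorem schwartz (s : 𝓢(ℝ, ℂ)) : IsFourierL1 s := by
  have hc : (-(2 * Real.pi) : ℝ) ≠ 0 := by simp [Real.pi_ne_zero]
  refine ⟨(𝓕⁻ (schwartzDilate hc s) : 𝓢(ℝ, ℂ)), SchwartzMap.integrable _, funext fun z => ?_⟩
  rw [← schwartz_fourier_eq_fourierL1, FourierTransform.fourier_fourierInv_eq,
    schwartzDilate_apply]
  congr 1
  have := Real.pi_ne_zero
  field_simp

/-- The function `exp φ - 1` is `φ` times the Fourier transform `∑ φ ^ n / (n + 1)!`. -/
theorem exp_sub_one (h : IsFourierL1 φ) : IsFourierL1 fun z => cexp (φ z) - 1 := by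
  obtain ⟨C, hC⟩ := h.hasFourierRep
  have hle (r : ℝ) (hr : 0 ≤ r) (n : ℕ) :
      ((n + 1).factorial : ℝ)⁻¹ * r ^ n ≤ r ^ n / n.factorial := by
    rw [div_eq_inv_mul]
    gcongr
    exact n.le_succ
  have hs : ∀ z, Summable fun n : ℕ => ((n + 1).factorial : ℂ)⁻¹ * φ z ^ n := by
    intro z
    refine Summable.of_norm_bounded (Real.summable_pow_div_factorial ‖φ z‖) fun n => ?_
    simpa using hle ‖φ z‖ (norm_nonneg _) n
  have hR : ∃ D, HasFourierRep ⊤ (fun z => ∑' n : ℕ, ((n + 1).factorial : ℂ)⁻¹ * φ z ^ n) D := by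
    refine ⟨_, HasFourierRep.hasSum (fun n => (hC.pow n).const_mul _) ?_ fun z => (hs z).hasSum⟩
    rw [← NNReal.summable_coe]
    refine Summable.of_nonneg_of_le (fun n => by positivity) (fun n => ?_)
      (Real.summable_pow_div_factorial C)
    simpa using hle C C.2 n
  obtain ⟨D, hD⟩ := hR
  convert h.mul hD using 2 with z
  have h1 : HasSum (fun n : ℕ => (n.factorial : ℂ)⁻¹ * φ z ^ n) (cexp (φ z)) := by
    simpa [Complex.exp_eq_exp_ℂ] using NormedSpace.exp_series_hasSum_exp' (𝕂 := ℂ) (φ z)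
  have h2 := (hasSum_nat_add_iff' 1).2 h1
  simp only [Finset.range_one, Finset.sum_singleton, Nat.factorial_zero, Nat.cast_one, inv_one,
    pow_zero, mul_one] at h2
  refine h2.unique ?_
  have h3 := (hs z).hasSum.mul_left (φ z)
  simpa only [pow_succ', mul_left_comm] using h3

theorem pow_sub_one (h : IsFourierL1 fun z => φ z - 1) (n : ℕ) :
    IsFourierL1 fun z => φ z ^ n - 1 := by
  obtain ⟨C, hC⟩ := h.hasFourierRep
  have h1 := hC.add (HasFourierRep.one MeasurableSet.univ)
  simp only [sub_add_cancel] at h1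
  induction n with
  | zero => exact ⟨0, integrable_zero _ _ _, by ext; simp [fourierL1]⟩
  | succ n ih =>
    convert (h.mul (h1.pow n)).add ih using 2 with z
    ring

end IsFourierL1

/-- A continuous function vanishing at infinity is a uniform limit of Schwartz functions. -/
theorem exists_schwartz_norm_sub_le {φ : ℝ → ℂ} (hφ : Continuous φ)
    (h0 : Tendsto φ (cocompact ℝ) (𝓝 0)) {δ : ℝ} (hδ : 0 < δ) :
    ∃ s : 𝓢(ℝ, ℂ), ∀ z, ‖φ z - s z‖ ≤ δ := by
  -- Shrink the modulus of `φ` by `δ / 2` to make the support compact, then regularize.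
  set η := δ / 2 with hη
  have hη0 : 0 < η := by positivity
  let f : ℝ → ℂ := fun z => φ z * (max (‖φ z‖ - η) 0 / max ‖φ z‖ η : ℝ)
  have hmax : ∀ z, 0 < max ‖φ z‖ η := fun z => hη0.trans_le (le_max_right _ _)
  have hf : Continuous f := by
    refine hφ.mul (continuous_ofReal.comp (Continuous.div (by fun_prop) (by fun_prop) ?_))
    exact fun z => (hmax z).ne'
  have hfc : HasCompactSupport f := by
    have := h0.norm.eventually_lt_const (u := η) (by simpa using hη0)
    obtain ⟨K, hK, hK'⟩ := mem_cocompact.1 this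
    refine HasCompactSupport.intro hK fun z hz => ?_
    have : ‖φ z‖ < η := hK' hz
    simp only [f]
    rw [max_eq_right (by linarith)]
    simp
  have hfφ : ∀ z, ‖φ z - f z‖ ≤ η := by
    intro z
    have : φ z - f z = φ z * ((1 - max (‖φ z‖ - η) 0 / max ‖φ z‖ η : ℝ) : ℂ) := by
      simp only [f]; push_cast; ring
    rw [this, norm_mul, norm_real, Real.norm_eq_abs]
    rcases le_total ‖φ z‖ η with h | h
    · rw [max_eq_right (by linarith)]; simpa using h
    · have h' : 0 < ‖φ z‖ := hη0.trans_le h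
      rw [max_eq_left (by linarith), max_eq_left h]
      have : 1 - (‖φ z‖ - η) / ‖φ z‖ = η / ‖φ z‖ := by field_simp; ring
      rw [this, abs_of_nonneg (by positivity), mul_div_cancel₀ _ h'.ne']
  obtain ⟨g, hg1, hg2, hg3⟩ := hf.exists_contDiff_approx ⊤ (ε := fun _ => η) (by fun_prop)
    (fun _ => hη0)
  refine ⟨(hfc.mono hg3).toSchwartzMap hg1, fun z => ?_⟩
  have h1 := hfφ z
  have h2 := hg2 z
  rw [dist_comm, dist_eq_norm] at h2
  calc ‖φ z - g z‖ = ‖(φ z - f z) + (f z - g z)‖ := by ring_nf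
    _ ≤ η + η := (norm_add_le _ _).trans (add_le_add h1 h2.le)
    _ = δ := by rw [hη]; ring

/-! ### Continuous logarithms and their limits -/

theorem exists_continuous_log {g : ℝ → ℂ} (hg : Continuous g) (h0 : ∀ z, g z ≠ 0) :
    ∃ f : ℝ → ℂ, Continuous f ∧ ∀ z, cexp (f z) = g z := by
  have hs : SimplyConnectedSpace ℝ := inferInstance
  obtain ⟨f, ⟨-, hf⟩, -⟩ := isCoveringMapOn_exp.existsUnique_continuousMap_lifts
    ⟨g, hg⟩ (exp_log (h0 0)) (fun x => h0 x)
  exact ⟨f, f.continuous, fun z => congrFun hf z⟩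

/-- A continuous logarithm of the constant function `1` is constant. -/
theorem exists_int_of_exp_eq_one {S : Set ℝ} (hS : IsPreconnected S) {f : ℝ → ℂ}
    (hf : ContinuousOn f S) (h1 : ∀ z ∈ S, cexp (f z) = 1) :
    ∃ n : ℤ, ∀ z ∈ S, f z = n * (2 * Real.pi * I) := by
  have hT : IsDiscrete (Set.range ((↑) : ℤ → ℝ)) :=
    Int.isClosedEmbedding_coe_real.isInducing.isDiscrete_range
  have hpi : (2 * Real.pi * I : ℂ) ≠ 0 := Complex.two_pi_I_ne_zero
  have hc : ContinuousOn (fun z => (f z / (2 * Real.pi * I)).re) S :=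
    continuous_re.comp_continuousOn (hf.div_const _)
  have hm : Set.MapsTo (fun z => (f z / (2 * Real.pi * I)).re) S (Set.range ((↑) : ℤ → ℝ)) := by
    intro z hz
    obtain ⟨n, hn⟩ := Complex.exp_eq_one_iff.1 (h1 z hz)
    exact ⟨n, by simp only [hn]; rw [mul_div_cancel_right₀ _ hpi]; simp⟩
  obtain ⟨_, ⟨n, rfl⟩, hn⟩ := hS.eqOn_const_of_mapsTo hT hc hm ⟨_, ⟨0, rfl⟩⟩
  refine ⟨n, fun z hz => ?_⟩
  obtain ⟨m, hm'⟩ := Complex.exp_eq_one_iff.1 (h1 z hz)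
  have := hn hz
  simp only [hm', Function.const_apply] at this
  rw [mul_div_cancel_right₀ _ hpi] at this
  rw [hm']
  have hmn : m = n := by exact_mod_cast (by simpa using this : (m : ℝ) = n)
  rw [hmn]

theorem exists_int_tendsto_atTop {f : ℝ → ℂ} (hf : Continuous f)
    (h1 : Tendsto (fun z => cexp (f z)) atTop (𝓝 1)) :
    ∃ n : ℤ, Tendsto f atTop (𝓝 (n * (2 * Real.pi * I))) := by
  have hev : ∀ᶠ z in atTop, cexp (f z) ∈ slitPlane :=
    h1.eventually (isOpen_slitPlane.mem_nhds one_mem_slitPlane)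
  obtain ⟨Z, hZ⟩ := eventually_atTop.1 hev
  obtain ⟨n, hn⟩ := exists_int_of_exp_eq_one (S := Set.Ici Z) isPreconnected_Ici
    (f := fun z => f z - log (cexp (f z)))
    (hf.continuousOn.sub ((hf.cexp.continuousOn).clog fun z hz => hZ z hz)) (fun z _ => by
      rw [Complex.exp_sub, exp_log (Complex.exp_ne_zero _), div_self (Complex.exp_ne_zero _)])
  refine ⟨n, ?_⟩
  have hl : Tendsto (fun z => n * (2 * Real.pi * I) + log (cexp (f z))) atTop
      (𝓝 (n * (2 * Real.pi * I) + log 1)) :=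
    (h1.clog one_mem_slitPlane).const_add _
  rw [log_one, add_zero] at hl
  refine hl.congr' ?_
  filter_upwards [eventually_ge_atTop Z] with z hz
  rw [← hn z hz]
  ring

theorem exists_int_tendsto_atBot {f : ℝ → ℂ} (hf : Continuous f)
    (h1 : Tendsto (fun z => cexp (f z)) atBot (𝓝 1)) :
    ∃ n : ℤ, Tendsto f atBot (𝓝 (n * (2 * Real.pi * I))) := by
  obtain ⟨n, hn⟩ := exists_int_tendsto_atTop (hf.comp continuous_neg)
    (h1.comp tendsto_neg_atTop_atBot)
  refine ⟨n, ?_⟩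
  simpa [Function.comp_def] using hn.comp tendsto_neg_atBot_atTop

/-! ### The phase `2 arctan` -/

theorem tendsto_arctan_atTop' : Tendsto (fun z : ℝ => ((Real.arctan z : ℝ) : ℂ)) atTop
    (𝓝 (Real.pi / 2)) := by
  have := (continuous_ofReal.tendsto _).comp
    (Real.tendsto_arctan_atTop.mono_right nhdsWithin_le_nhds)
  simpa [Function.comp_def] using this

theorem tendsto_arctan_atBot' : Tendsto (fun z : ℝ => ((Real.arctan z : ℝ) : ℂ)) atBot
    (𝓝 (-(Real.pi / 2))) := by
  have := (continuous_ofReal.tendsto _).comp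
    (Real.tendsto_arctan_atBot.mono_right nhdsWithin_le_nhds)
  simpa [Function.comp_def] using this

theorem one_sub_mul_I_ne_zero (z : ℝ) : (1 - z * I : ℂ) ≠ 0 := by
  intro h
  simpa using congrArg re h

theorem exp_two_arctan (z : ℝ) :
    cexp (2 * I * Real.arctan z) = (1 + z * I) / (1 - z * I) := by
  have h2 : cexp (Real.arctan z * I) = (1 + z * I) / Real.sqrt (1 + z ^ 2) := by
    rw [exp_mul_I, ← ofReal_cos, ← ofReal_sin, Real.cos_arctan, Real.sin_arctan]
    push_cast
    ring
  have h3 : (Real.sqrt (1 + z ^ 2) : ℂ) ^ 2 = (1 + z * I) * (1 - z * I) := by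
    rw [← ofReal_pow, Real.sq_sqrt (by positivity)]
    push_cast
    linear_combination (z : ℂ) ^ 2 * I_sq
  have h4 : (1 + z * I : ℂ) ≠ 0 := by
    simpa using one_sub_mul_I_ne_zero (-z)
  rw [show 2 * I * (Real.arctan z : ℂ) = (2 : ℕ) * (Real.arctan z * I) by push_cast; ring,
    Complex.exp_nat_mul, h2, div_pow, h3, sq, mul_div_mul_left _ _ h4]

theorem isFourierL1_inv_one_sub_mul_I : IsFourierL1 fun z => (1 - z * I : ℂ)⁻¹ := by
  have hi : IntegrableOn (fun x : ℝ => cexp (-x)) (Set.Ioi 0) := by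
    simpa using integrableOn_exp_mul_complex_Ioi (a := -1) (by simp) 0
  refine ⟨(Set.Ioi (0 : ℝ)).indicator fun x => cexp (-x), hi.integrable_indicator
    measurableSet_Ioi, funext fun z => ?_⟩
  have h1 : (fun x : ℝ => cexp (z * x * I) * (Set.Ioi (0 : ℝ)).indicator (fun x => cexp (-x)) x) =
      (Set.Ioi (0 : ℝ)).indicator fun x : ℝ => cexp (-(1 - z * I) * x) := by
    ext x
    by_cases hx : x ∈ Set.Ioi (0 : ℝ)
    · simp only [Set.indicator_of_mem hx, ← Complex.exp_add]
      congr 1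
      ring
    · simp [Set.indicator_of_notMem hx]
  rw [fourierL1, h1, integral_indicator measurableSet_Ioi,
    integral_exp_mul_complex_Ioi (by simp)]
  rw [ofReal_zero, mul_zero, Complex.exp_zero, neg_div_neg_eq, one_div]

/-- The function `exp (n (2i arctan z + iπ))` is the `n`-th power of a function of modulus one with
winding number one along the real line, and tends to `1` at both ends. -/
theorem isFourierL1_exp_arctan_sub_one (n : ℤ) :
    IsFourierL1 fun z => cexp (n * (2 * I * Real.arctan z + Real.pi * I)) - 1 := by
  have h1 : IsFourierL1 fun z => cexp (2 * I * Real.arctan z + Real.pi * I) - 1 := by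
    convert isFourierL1_inv_one_sub_mul_I.const_mul (-2) using 2 with z
    rw [Complex.exp_add, exp_two_arctan, exp_pi_mul_I]
    have := one_sub_mul_I_ne_zero z
    field_simp
    ring
  obtain ⟨m, rfl | rfl⟩ := n.eq_nat_or_neg
  · convert h1.pow_sub_one m using 2 with z
    rw [← Complex.exp_nat_mul]
    simp
  · convert (h1.pow_sub_one m).comp_neg using 2 with z
    rw [← Complex.exp_nat_mul]
    congr 1
    refine Complex.exp_eq_exp_iff_exists_int.2 ⟨-m, ?_⟩
    rw [Real.arctan_neg]
    push_cast
    ring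

/-! ### The lattice part -/

theorem HasFourierRep.periodic {h : ℝ} (hh : h ≠ 0) {φ : ℝ → ℂ} {C : ℝ≥0}
    (hφ : HasFourierRep (AddSubgroup.zmultiples h) φ C) :
    Function.Periodic φ (2 * Real.pi / h) := by
  obtain ⟨-, ρ, h1, h2, h3, h4⟩ := hφ
  intro z
  rw [h4, h4]
  refine integral_congr_ae (h2.mono fun p hp => ?_)
  obtain ⟨k, hk⟩ := hp
  simp only [zsmul_eq_mul] at hk ⊢
  rw [← hk]
  congr 1
  refine Complex.exp_eq_exp_iff_exists_int.2 ⟨k, ?_⟩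
  have : (h : ℂ) ≠ 0 := by exact_mod_cast hh
  push_cast
  field_simp

theorem IsTrigPoly.hasFourierRep {h : ℝ} {T : ℝ → ℂ} (hT : IsTrigPoly h T) :
    ∃ C, HasFourierRep (AddSubgroup.zmultiples h) T C := by
  obtain ⟨d, P, hP⟩ := hT
  have hG := measurableSet_zmultiples h
  have h1 := HasFourierRep.character hG (x := -(d * h)) (neg_mem ⟨d, by simp⟩)
  have h2 := HasFourierRep.finsetSum hG (Finset.range (P.natDegree + 1)) fun j _ =>
    (((HasFourierRep.character hG (AddSubgroup.mem_zmultiples h)).pow j).const_mul (P.coeff j))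
  simp only [← Polynomial.eval_eq_sum_range] at h2
  exact ⟨_, (funext hP) ▸ h1.mul h2⟩

/-- A continuous periodic function is a uniform limit of trigonometric polynomials. -/
theorem exists_isTrigPoly_norm_sub_le {h : ℝ} (hh : 0 < h) {φ : ℝ → ℂ} (hφ : Continuous φ)
    (hp : Function.Periodic φ (2 * Real.pi / h)) {δ : ℝ} (hδ : 0 < δ) :
    ∃ T, IsTrigPoly h T ∧ ∀ z, ‖φ z - T z‖ ≤ δ := by
  have : Fact (0 < 2 * Real.pi / h) := ⟨by positivity⟩
  let f : C(AddCircle (2 * Real.pi / h), ℂ) := ⟨hp.lift, continuous_coinduced_dom.2 hφ⟩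
  have hf : f ∈ (Submodule.span ℂ (Set.range (@fourier (2 * Real.pi / h)))).topologicalClosure := by
    rw [span_fourier_closure_eq_top]; trivial
  obtain ⟨g, hg, hfg⟩ := Metric.mem_closure_iff.1 hf δ hδ
  refine ⟨fun z => g z, ?_, fun z => ?_⟩
  · clear hfg
    induction hg using Submodule.span_induction with
    | mem x hx =>
      obtain ⟨k, rfl⟩ := hx
      convert IsTrigPoly.monomial (h := h) 1 k using 2 with z
      rw [fourier_coe_apply, one_mul]
      congr 1
      have h1 : (h : ℂ) ≠ 0 := by exact_mod_cast hh.ne'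
      have h2 : (Real.pi : ℂ) ≠ 0 := by exact_mod_cast Real.pi_ne_zero
      push_cast
      field_simp
    | zero => exact IsTrigPoly.zero
    | add x y _ _ hx hy => exact hx.add hy
    | smul a x _ hx => 
      obtain ⟨d, P, hP⟩ := hx
      refine ⟨d, Polynomial.C a * P, fun z => ?_⟩
      rw [Polynomial.eval_mul, Polynomial.eval_C, mul_left_comm, ← hP]
      rfl
  · rw [← dist_eq_norm]
    exact (ContinuousMap.dist_apply_le_dist (z : AddCircle (2 * Real.pi / h))).trans hfg.le

theorem Function.Periodic.exists_norm_lower_bound {g : ℝ → ℂ} (hg : Continuous g) {T : ℝ}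
    (hT : 0 < T) (hp : Function.Periodic g T) (h0 : ∀ z, g z ≠ 0) :
    ∃ c : ℝ, 0 < c ∧ ∀ z, c ≤ ‖g z‖ := by
  obtain ⟨x, hx, hmin⟩ := isCompact_Icc.exists_isMinOn (Set.nonempty_Icc.2 hT.le)
    hg.norm.continuousOn
  refine ⟨‖g x‖, norm_pos_iff.2 (h0 x), fun z => ?_⟩
  obtain ⟨y, hy, hzy⟩ := hp.exists_mem_Ico₀ hT z
  rw [hzy]
  exact hmin ⟨hy.1, hy.2.le⟩

/-! ### The logarithm of the characteristic function -/

theorem isFourierL1_charFun {m : Measure ℝ} [IsFiniteMeasure m] (hm : m ≪ volume) :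
    IsFourierL1 (charFun m) := by
  refine ⟨fun x => ((m.rnDeriv volume x).toReal : ℂ), Measure.integrable_toReal_rnDeriv.ofReal,
    funext fun z => ?_⟩
  rw [charFun_apply_real, fourierL1, ← integral_rnDeriv_smul hm]
  refine integral_congr_ae (Eventually.of_forall fun x => ?_)
  simp only [real_smul]
  ring

theorem IsFourierL1.tendsto_zero {φ : ℝ → ℂ} (h : IsFourierL1 φ) :
    Tendsto φ (cocompact ℝ) (𝓝 0) := by
  obtain ⟨q, -, rfl⟩ := h
  have hc : (-(2 * Real.pi)⁻¹ : ℝ) ≠ 0 := by simp [Real.pi_ne_zero]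
  have h1 := (Real.zero_at_infty_fourier q).comp
    (Homeomorph.mulLeft₀ _ hc).isClosedEmbedding.tendsto_cocompact
  refine h1.congr fun z => ?_
  simp only [Function.comp_apply, Homeomorph.coe_mulLeft₀]
  rw [Real.fourier_eq', fourierL1]
  refine integral_congr_ae (Eventually.of_forall fun x => ?_)
  simp only [smul_eq_mul]
  congr 2
  have : (Real.pi : ℂ) ≠ 0 := by exact_mod_cast Real.pi_ne_zero
  simp
  field_simp

theorem norm_exp_sub_one_le_of_le {w : ℂ} {δ : ℝ} (hw : ‖w‖ ≤ δ) (hδ : δ ≤ 1) :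
    ‖cexp w - 1‖ ≤ 2 * δ :=
  (Complex.norm_exp_sub_one_le (hw.trans hδ)).trans (by linarith)

/-- The characteristic function of `md` on `r + hℤ` is `exp (i (r + k h) z)` times the exponential
of a continuous periodic function. The integer `k` is the winding number of the periodic function
`g` over one period. -/
theorem exists_periodic_log {md : Measure ℝ} [IsFiniteMeasure md] {r h : ℝ} (hh : 0 < h)
    (hd : ∀ᵐ x ∂md, x ∈ lattice r h) (h0 : ∀ z, charFun md z ≠ 0) :
    ∃ (g Λ : ℝ → ℂ) (C : ℝ≥0) (k : ℤ), HasFourierRep (AddSubgroup.zmultiples h) g C ∧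
      (∃ c : ℝ, 0 < c ∧ ∀ z, c ≤ ‖g z‖) ∧
      (∀ z, charFun md z = cexp (z * r * I) * g z) ∧ Continuous Λ ∧
      Function.Periodic Λ (2 * Real.pi / h) ∧
      ∀ z, g z = cexp (z * (k * h : ℝ) * I) * cexp (Λ z) := by
  have hG := measurableSet_zmultiples h
  have hT : 0 < 2 * Real.pi / h := by positivity
  let m := md.map (· + -r)
  have hm : ∀ᵐ x ∂m, x ∈ AddSubgroup.zmultiples h := by
    refine (ae_map_iff (by fun_prop) hG).2 (hd.mono fun x hx => ?_)
    obtain ⟨k, rfl⟩ := hx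
    exact ⟨k, by simp; ring⟩
  have hg := HasFourierRep.charFun hG hm
  set g := charFun m with hgdef
  have hgr : ∀ z, charFun md z = cexp (z * r * I) * g z := by
    intro z
    rw [hgdef, charFun_map_add_const, mul_left_comm, ← Complex.exp_add]
    convert (mul_one _).symm
    rw [← Complex.exp_zero]
    congr 1
    simp
  have hg0 : ∀ z, g z ≠ 0 := fun z hz => h0 z (by rw [hgr, hz, mul_zero])
  obtain ⟨Ψ, hΨc, hΨ⟩ := exists_continuous_log hg.continuous hg0
  have hper := hg.periodic hh.ne'
  obtain ⟨k, hk⟩ := exists_int_of_exp_eq_one (S := Set.univ) isPreconnected_univ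
    (f := fun z => Ψ (z + 2 * Real.pi / h) - Ψ z) (by fun_prop) (fun z _ => by
      rw [Complex.exp_sub, hΨ, hΨ, hper z, div_self (hg0 z)])
  have hh' : (h : ℂ) ≠ 0 := by exact_mod_cast hh.ne'
  refine ⟨g, fun z => Ψ z - z * (k * h : ℝ) * I, _, k, hg,
    Function.Periodic.exists_norm_lower_bound hg.continuous hT hper hg0, hgr, by fun_prop,
    fun z => ?_, fun z => ?_⟩
  · have := hk z trivial
    simp only at this ⊢
    rw [sub_eq_iff_eq_add.1 this]
    push_cast
    field_simp
    ring
  · rw [← Complex.exp_add, ← hΨ]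
    congr 1
    ring

/-- A zero-free continuous function `1 + F` with `F` vanishing at infinity has the form
`exp (n (2i arctan z + iπ)) exp (Λ z)`, with `Λ` vanishing at infinity. The integer `n` is the
winding number of `1 + F` along the real line. -/
theorem exists_log_vanishing_at_infinity {F : ℝ → ℂ} (hF : Continuous F)
    (hF0 : Tendsto F (cocompact ℝ) (𝓝 0)) (h1 : ∀ z, 1 + F z ≠ 0) :
    ∃ (Λ : ℝ → ℂ) (n : ℤ), Continuous Λ ∧ Tendsto Λ (cocompact ℝ) (𝓝 0) ∧
      ∀ z, 1 + F z = cexp (n * (2 * I * Real.arctan z + Real.pi * I)) * cexp (Λ z) := by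
  obtain ⟨Ψ, hΨc, hΨ⟩ := exists_continuous_log (g := fun z => 1 + F z) (by fun_prop) h1
  have hlim : Tendsto (fun z => cexp (Ψ z)) (cocompact ℝ) (𝓝 1) := by
    simpa [hΨ] using hF0.const_add 1
  rw [cocompact_eq_atBot_atTop] at hlim
  obtain ⟨p, hp⟩ := exists_int_tendsto_atTop hΨc (hlim.mono_left le_sup_right)
  obtain ⟨m, hm⟩ := exists_int_tendsto_atBot hΨc (hlim.mono_left le_sup_left)
  have hcont : Continuous fun z : ℝ => ((Real.arctan z : ℝ) : ℂ) :=
    continuous_ofReal.comp Real.continuous_arctan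
  refine ⟨fun z => Ψ z - m * (2 * Real.pi * I) -
    (p - m : ℤ) * (2 * I * Real.arctan z + Real.pi * I), p - m, by fun_prop, ?_, fun z => ?_⟩
  · rw [cocompact_eq_atBot_atTop, tendsto_sup]
    constructor
    · have := (hm.sub_const (m * (2 * Real.pi * I))).sub
        (((tendsto_arctan_atBot'.const_mul (2 * I)).add_const (Real.pi * I)).const_mul
          ((p - m : ℤ) : ℂ))
      convert this using 2
      ring
    · have := (hp.sub_const (m * (2 * Real.pi * I))).sub
        (((tendsto_arctan_atTop'.const_mul (2 * I)).add_const (Real.pi * I)).const_mul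
          ((p - m : ℤ) : ℂ))
      convert this using 2
      push_cast
      ring
  · rw [← hΨ, ← Complex.exp_add]
    refine Complex.exp_eq_exp_iff_exists_int.2 ⟨m, ?_⟩
    ring

/-- If `t` and `s` approximate the two continuous logarithms `Λd` and `Λa`, what is left is
`exp (Λd + Λa - t - s) = 1 + v + w` with `v` a small Fourier transform on the lattice and `w` a
small Fourier transform of an integrable function. Its spectral radius is small, so that it has a
logarithm in the algebra of Fourier transforms of complex measures. -/
theorem exists_charFun_eq_exp {md ma : Measure ℝ} [IsFiniteMeasure md] [IsFiniteMeasure ma]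
    {r h : ℝ} (hh : 0 < h) (hd : ∀ᵐ x ∂md, x ∈ lattice r h) (ha : ma ≪ volume)
    (h0 : ∀ z, charFun md z ≠ 0) (h1 : ∀ z, charFun (md + ma) z ≠ 0) :
    ∃ (γ : ℝ) (n : ℤ) (R : ℝ → ℂ) (C : ℝ≥0), HasFourierRep ⊤ R C ∧ ∀ z : ℝ,
      charFun (md + ma) z = cexp (I * γ * z + n * (2 * I * Real.arctan z) + R z) := by
  have hTop : MeasurableSet ((⊤ : AddSubgroup ℝ) : Set ℝ) := MeasurableSet.univ
  obtain ⟨g, Λd, C, k, hg, ⟨c, hc, hcg⟩, hdg, hΛd, hΛdp, hgΛ⟩ := exists_periodic_log hh hd h0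
  have hF := isFourierL1_charFun ha
  obtain ⟨CF, hCF⟩ := hF.hasFourierRep
  have hadd : ∀ z, charFun (md + ma) z = charFun md z + charFun ma z := by
    intro z
    simp only [charFun_apply_real]
    refine integral_add_measure ?_ ?_ <;>
    · refine (integrable_const (1 : ℝ)).mono' (by fun_prop) (Eventually.of_forall fun x => ?_)
      rw [norm_cexp_mul_I]
  have hdc : Continuous (charFun md) := by
    rw [funext hdg]
    have := hg.continuous
    fun_prop
  have hmd : ∀ z, ‖charFun md z‖ = ‖g z‖ := by
    intro z; rw [hdg, norm_mul, norm_cexp_mul_I, one_mul]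
  obtain ⟨Λa, n, hΛa, hΛa0, hFΛ⟩ := exists_log_vanishing_at_infinity
    (F := fun z => charFun ma z / charFun md z) (hCF.continuous.div hdc h0) (by
      refine squeeze_zero_norm (fun z => ?_) (by simpa using (hF.tendsto_zero.norm.mul_const c⁻¹))
      rw [norm_div, hmd, div_eq_mul_inv]
      gcongr
      exact hcg z) (fun z hz => h1 z (by
        rw [hadd]
        have := h0 z
        field_simp at hz
        simpa using hz))
  -- Any small `δ` will do, as long as the spectral radii of `v` and `w` add up to less than `1`.
  obtain ⟨t, ht, htΛ⟩ := exists_isTrigPoly_norm_sub_le hh hΛd hΛdp (δ := 1 / 40) (by norm_num)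
  obtain ⟨s, hsΛ⟩ := exists_schwartz_norm_sub_le hΛa hΛa0 (δ := 1 / 40) (by norm_num)
  obtain ⟨Ct, hCt⟩ := ht.hasFourierRep
  obtain ⟨De, hDe⟩ := hCt.neg.exp_comp
  have hs := IsFourierL1.schwartz s
  obtain ⟨Cs, hCs⟩ := hs.hasFourierRep
  obtain ⟨Ds, hDs⟩ := hCs.neg.exp_comp
  set v : ℝ → ℂ := fun z => cexp (Λd z - t z) - 1 with hv
  set w : ℝ → ℂ := fun z => cexp (Λd z - t z) * (cexp (Λa z - s z) - 1) with hw
  -- `v` lies in the algebra of the lattice, and its supremum is small.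
  have hE : ∀ z, cexp (Λd z - t z) = g z * (cexp (z * (-(k * h) : ℝ) * I) * cexp (-t z)) := by
    intro z
    rw [hgΛ, ← Complex.exp_add, ← Complex.exp_add, ← Complex.exp_add]
    congr 1
    push_cast
    ring
  have hErep := hg.mul ((HasFourierRep.character hg.1 (x := -(k * h))
    (neg_mem ⟨k, by simp⟩)).mul hDe)
  simp only [← hE] at hErep
  have hvrep := hErep.sub (HasFourierRep.one hg.1)
  have hvs : ∀ z, ‖v z‖ ≤ 2 * (1 / 40) := fun z =>
    norm_exp_sub_one_le_of_le (htΛ z) (by norm_num)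
  have hvP : PowerBounded ⊤ v (1 / 10) :=
    (hvrep.powerBounded_of_lattice hh.ne' (M := 1 / 20) (fun z => (hvs z).trans (by norm_num))
      (by rw [← NNReal.coe_lt_coe]; norm_num)).of_le le_top hTop
  -- `w` lies in the ideal: it is the sum of a multiple of `charFun ma` and of a multiple of
  -- `Q - 1`, where `Q` is the product of the two factors that compensate `n` and `s`.
  have hQ : IsFourierL1 fun z =>
      cexp ((-n : ℤ) * (2 * I * Real.arctan z + Real.pi * I)) * cexp (-s z) - 1 := by
    have hs' : IsFourierL1 fun z => -s z := by simpa using hs.const_mul (-1)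
    convert ((isFourierL1_exp_arctan_sub_one (-n)).mul hDs).add hs'.exp_sub_one using 2 with z
    ring
  obtain ⟨CQ, hCQ⟩ := hQ.hasFourierRep
  have hCQ' := hCQ.add (HasFourierRep.one hTop)
  simp only [sub_add_cancel] at hCQ'
  have hwL1 : IsFourierL1 w := by
    have e1 := (hF.mul ((HasFourierRep.character hTop (x := -r - k * h) trivial).mul
      (hDe.of_le le_top hTop))).mul hCQ'
    have e2 := hQ.mul (hErep.of_le le_top hTop)
    convert e1.add e2 using 2 with z
    have hx : cexp (Λa z - s z) = (1 + charFun ma z / charFun md z) *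
        (cexp ((-n : ℤ) * (2 * I * Real.arctan z + Real.pi * I)) * cexp (-s z)) := by
      rw [hFΛ, ← Complex.exp_add, ← Complex.exp_add, ← Complex.exp_add]
      congr 1
      push_cast
      ring
    have hy : cexp (Λd z - t z) / charFun md z =
        cexp (z * (-r - k * h : ℝ) * I) * cexp (-t z) := by
      rw [div_eq_iff (h0 z), hdg, hE]
      have : cexp (z * (-(k * h) : ℝ) * I) =
          cexp (z * (-r - k * h : ℝ) * I) * cexp (z * r * I) := by
        rw [← Complex.exp_add]
        congr 1
        push_cast
        ring
      rw [this]
      ring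
    simp only [hw]
    rw [hx, ← hy]
    ring
  have hus : ∀ z, ‖v z + w z‖ ≤ 2 * (1 / 20) := by
    intro z
    have : v z + w z = cexp ((Λd z - t z) + (Λa z - s z)) - 1 := by
      rw [Complex.exp_add]; simp only [hv, hw]; ring
    rw [this]
    refine norm_exp_sub_one_le_of_le ((norm_add_le _ _).trans ?_) (by norm_num)
    linarith [htΛ z, hsΛ z]
  have hws : ∀ z, ‖w z‖ ≤ 3 / 20 := by
    intro z
    have := norm_sub_le (v z + w z) (v z)
    rw [add_sub_cancel_left] at this
    linarith [hus z, hvs z]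
  have hwP : PowerBounded ⊤ w (1 / 5) := hwL1.powerBounded (M := 3 / 20)
    (fun z => by simpa using hws z) (by rw [← NNReal.coe_lt_coe]; norm_num)
  obtain ⟨D, hD⟩ := (hvP.add hwP).log_one_add (by rw [← NNReal.coe_lt_coe]; norm_num)
    (fun z => (hus z).trans_lt (by norm_num))
  refine ⟨r + k * h, n, fun z => t z + s z + log (1 + (v z + w z)) + (n * (Real.pi * I)) * 1, _,
    (((hCt.of_le le_top hTop).add hCs).add hD).add ((HasFourierRep.one hTop).const_mul _),
    fun z => ?_⟩
  have e1 : 1 + (v z + w z) = cexp ((Λd z - t z) + (Λa z - s z)) := by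
    rw [Complex.exp_add]; simp only [hv, hw]; ring
  have e2 : cexp (log (1 + (v z + w z))) = 1 + (v z + w z) :=
    exp_log (by rw [e1]; exact Complex.exp_ne_zero _)
  have e3 : charFun (md + ma) z =
      charFun md z * (1 + charFun ma z / charFun md z) := by
    rw [hadd, mul_add, mul_one, mul_div_cancel₀ _ (h0 z)]
  rw [e3, hFΛ, hdg, hgΛ, ← add_assoc, ← add_assoc, Complex.exp_add, Complex.exp_add, e2, e1]
  simp only [← Complex.exp_add]
  congr 1
  push_cast
  ring

/-! ### Exponents with a quasi-Lévy type measure given as a difference of measures -/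

/-- `P` integrates `min 1 x²`. -/
def IsLevyIntegrable (P : Measure ℝ) : Prop := ∫⁻ x, ENNReal.ofReal (min 1 (x ^ 2)) ∂P < ⊤

/-- `ψ` is the exponent of a Lévy–Khintchine representation whose quasi-Lévy type measure is the
difference `P - N` of two positive measures. The measures need not be mutually singular, and may
charge `{0}`, where the integrand vanishes. -/
def IsQuasiExponent (ψ : ℝ → ℂ) : Prop :=
  ∃ (a γ : ℝ) (P N : Measure ℝ), IsLevyIntegrable P ∧ IsLevyIntegrable N ∧
    ∀ z : ℝ, ψ z = -(1 / 2) * a * z ^ 2 + I * γ * z +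
      ((∫ x, levyKernel z x ∂P) - ∫ x, levyKernel z x ∂N)

theorem measurable_levyKernel (z : ℝ) : Measurable (levyKernel z) := by
  unfold levyKernel
  have : Measurable fun x : ℝ =>
      (Set.Icc (-1 : ℝ) 1).indicator (fun _ => (1 : ℂ)) x :=
    measurable_const.indicator measurableSet_Icc
  fun_prop

theorem norm_levyKernel_le (z x : ℝ) :
    ‖levyKernel z x‖ ≤ (3 * z ^ 2 + 2) * min 1 (x ^ 2) := by
  by_cases hx : x ∈ Set.Icc (-1 : ℝ) 1
  · have hx2 : x ^ 2 ≤ 1 := by nlinarith [hx.1, hx.2]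
    rw [levyKernel, Set.indicator_of_mem hx, mul_one, min_eq_right hx2]
    have hn : ‖(I * x * z : ℂ)‖ = |x * z| := by simp [abs_mul]
    suffices ‖cexp (I * x * z) - 1 - I * x * z‖ ≤ 3 * |x * z| ^ 2 by
      rw [sq_abs] at this
      nlinarith [sq_nonneg x]
    rcases le_total |x * z| 1 with h | h
    · have := Complex.norm_exp_sub_one_sub_id_le (x := I * x * z) (by rw [hn]; exact h)
      rw [hn] at this
      linarith [sq_nonneg |x * z|]
    · have h1 : ‖cexp (I * x * z)‖ = 1 := by
        rw [show (I * x * z : ℂ) = z * x * I by ring, norm_cexp_mul_I]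
      calc ‖cexp (I * x * z) - 1 - I * x * z‖ ≤ 1 + 1 + |x * z| := by
            refine (norm_sub_le _ _).trans (add_le_add ((norm_sub_le _ _).trans ?_) hn.le)
            rw [h1, norm_one]
        _ ≤ _ := by nlinarith
  · have hx2 : 1 ≤ x ^ 2 := by
      by_contra hlt
      exact hx (abs_le.1 (abs_le_one_iff_mul_self_le_one.2 (by nlinarith)))
    rw [levyKernel, Set.indicator_of_notMem hx, mul_zero, sub_zero, min_eq_left hx2, mul_one]
    have h1 : ‖cexp (I * x * z)‖ = 1 := by
      rw [show (I * x * z : ℂ) = z * x * I by ring, norm_cexp_mul_I]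
    refine (norm_sub_le _ _).trans ?_
    rw [h1, norm_one]
    nlinarith [sq_nonneg z]

theorem levyKernel_zero_right (z : ℝ) : levyKernel z 0 = 0 := by simp [levyKernel]

theorem levyKernel_zero_left (x : ℝ) : levyKernel 0 x = 0 := by simp [levyKernel]

theorem IsLevyIntegrable.integrable_min {P : Measure ℝ} (h : IsLevyIntegrable P) :
    Integrable (fun x : ℝ => min 1 (x ^ 2)) P := by
  refine ⟨by fun_prop, ?_⟩
  rw [hasFiniteIntegral_iff_ofReal (Eventually.of_forall fun x => by positivity)]
  exact h

theorem IsLevyIntegrable.integrable_levyKernel {P : Measure ℝ} (h : IsLevyIntegrable P) (z : ℝ) :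
    Integrable (levyKernel z) P :=
  (h.integrable_min.const_mul (3 * z ^ 2 + 2)).mono'
    (measurable_levyKernel z).aestronglyMeasurable (Eventually.of_forall (norm_levyKernel_le z))

theorem IsLevyIntegrable.add {P Q : Measure ℝ} (hP : IsLevyIntegrable P)
    (hQ : IsLevyIntegrable Q) : IsLevyIntegrable (P + Q) := by
  rw [IsLevyIntegrable, lintegral_add_measure]
  exact ENNReal.add_lt_top.2 ⟨hP, hQ⟩

theorem IsLevyIntegrable.mono {P Q : Measure ℝ} (hQ : IsLevyIntegrable Q) (h : P ≤ Q) :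
    IsLevyIntegrable P := (lintegral_mono' h le_rfl).trans_lt hQ

theorem isLevyIntegrable_of_isFiniteMeasure (P : Measure ℝ) [IsFiniteMeasure P] :
    IsLevyIntegrable P := by
  refine (lintegral_mono (g := fun _ => 1) fun x => ?_).trans_lt (by simp [measure_lt_top])
  simp

theorem isLevyIntegrable_zero : IsLevyIntegrable 0 := isLevyIntegrable_of_isFiniteMeasure 0

namespace IsQuasiExponent

variable {φ ψ : ℝ → ℂ}

theorem add (h : IsQuasiExponent φ) (h' : IsQuasiExponent ψ) :
    IsQuasiExponent fun z => φ z + ψ z := by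
  obtain ⟨a, γ, P, N, hP, hN, h⟩ := h
  obtain ⟨a', γ', P', N', hP', hN', h'⟩ := h'
  refine ⟨a + a', γ + γ', P + P', N + N', hP.add hP', hN.add hN', fun z => ?_⟩
  rw [integral_add_measure (hP.integrable_levyKernel z) (hP'.integrable_levyKernel z),
    integral_add_measure (hN.integrable_levyKernel z) (hN'.integrable_levyKernel z)]
  simp only [h, h']
  push_cast
  ring

theorem neg (h : IsQuasiExponent φ) : IsQuasiExponent fun z => -φ z := by
  obtain ⟨a, γ, P, N, hP, hN, h⟩ := h
  refine ⟨-a, -γ, N, P, hN, hP, fun z => ?_⟩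
  simp only [h]
  push_cast
  ring

theorem linear (γ : ℝ) : IsQuasiExponent fun z => I * γ * z :=
  ⟨0, γ, 0, 0, isLevyIntegrable_zero, isLevyIntegrable_zero, by simp⟩

theorem nat_mul (h : IsQuasiExponent φ) (n : ℕ) : IsQuasiExponent fun z => n * φ z := by
  induction n with
  | zero => simpa using linear 0
  | succ n ih =>
    convert ih.add h using 2
    push_cast
    ring

theorem int_mul (h : IsQuasiExponent φ) (n : ℤ) : IsQuasiExponent fun z => n * φ z := by
  obtain ⟨m, rfl | rfl⟩ := n.eq_nat_or_neg
  · simpa using h.nat_mul m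
  · simpa using (h.nat_mul m).neg

/-- Exponents with real data are hermitian. -/
theorem conj_neg (h : IsQuasiExponent φ) (z : ℝ) : (starRingEnd ℂ) (φ (-z)) = φ z := by
  obtain ⟨a, γ, P, N, -, -, h⟩ := h
  have hk : ∀ x, (starRingEnd ℂ) (levyKernel (-z) x) = levyKernel z x := by
    intro x
    by_cases hx : x ∈ Set.Icc (-1 : ℝ) 1 <;>
    simp [levyKernel, hx, ← Complex.exp_conj, sub_eq_add_neg]
  rw [h, h]
  simp only [map_add, map_sub, map_mul, map_pow, map_neg, ← integral_conj, hk, conj_ofReal, conj_I]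
  simp [map_ofNat]

theorem apply_zero (h : IsQuasiExponent φ) : φ 0 = 0 := by
  obtain ⟨a, γ, P, N, -, -, h⟩ := h
  simp [h, levyKernel_zero_left]

/-- The compound Poisson exponent. The compensator is absorbed by the linear term. -/
theorem charFun_sub (P : Measure ℝ) [IsFiniteMeasure P] :
    IsQuasiExponent fun z => charFun P z - charFun P 0 := by
  let c : ℝ → ℝ := (Set.Icc (-1 : ℝ) 1).indicator fun x => x
  have hc : Integrable c P := by
    refine (integrable_const (1 : ℝ)).mono'
      (measurable_id.indicator measurableSet_Icc).aestronglyMeasurable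
      (Eventually.of_forall fun x => ?_)
    by_cases hx : x ∈ Set.Icc (-1 : ℝ) 1
    · simp only [c, Set.indicator_of_mem hx, Real.norm_eq_abs]
      exact abs_le.2 hx
    · simp [c, hx]
  refine ⟨0, ∫ x, c x ∂P, P, 0, isLevyIntegrable_of_isFiniteMeasure P, isLevyIntegrable_zero,
    fun z => ?_⟩
  have hk : ∀ x, levyKernel z x = cexp (z * x * I) - 1 - I * z * (c x : ℂ) := by
    intro x
    rw [levyKernel, show (I * x * z : ℂ) = z * x * I by ring]
    by_cases hx : x ∈ Set.Icc (-1 : ℝ) 1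
    · simp only [c, Set.indicator_of_mem hx]; ring
    · simp [c, Set.indicator_of_notMem hx]
  have h1 : Integrable (fun x : ℝ => cexp (z * x * I)) P := by
    refine (integrable_const (1 : ℝ)).mono' (by fun_prop) (Eventually.of_forall fun x => ?_)
    rw [norm_cexp_mul_I]
  simp only [hk]
  have h2 : Integrable (fun x : ℝ => cexp (z * x * I) - 1) P := h1.sub (integrable_const _)
  have h3 : Integrable (fun x : ℝ => I * z * (c x : ℂ)) P := hc.ofReal.const_mul _
  rw [integral_sub h2 h3,
    integral_sub h1 (integrable_const _), integral_const_mul, integral_complex_ofReal,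
    charFun_apply_real]
  simp
  ring

end IsQuasiExponent

/-! ### Realization of a difference of measures as a quasi-Lévy type measure -/

theorem IsLevyIntegrable.measure_outside_lt_top {P : Measure ℝ} (hP : IsLevyIntegrable P) {r : ℝ}
    (hr : 0 < r) : P (outside r) < ⊤ := by
  have hm : 0 < min 1 (r ^ 2) := by positivity
  have hsub : outside r ⊆
      {x | ENNReal.ofReal (min 1 (r ^ 2)) ≤ ENNReal.ofReal (min 1 (x ^ 2))} := by
    intro x hx
    have : r ≤ |x| := by
      by_contra hlt
      exact hx (abs_lt.1 (not_le.1 hlt))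
    have h2 : r ^ 2 ≤ x ^ 2 := by rw [← sq_abs x]; gcongr
    exact ENNReal.ofReal_le_ofReal (min_le_min_left 1 h2)
  refine (measure_mono hsub).trans_lt ?_
  refine (meas_ge_le_lintegral_div (by fun_prop) (ENNReal.ofReal_pos.2 hm).ne'
    ENNReal.ofReal_ne_top).trans_lt ?_
  exact ENNReal.div_lt_top hP.ne (ENNReal.ofReal_pos.2 hm).ne'

theorem isFiniteMeasure_restrict_outside {P : Measure ℝ} (hP : IsLevyIntegrable P) {r : ℝ}
    (hr : 0 < r) : IsFiniteMeasure (P.restrict (outside r)) :=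
  ⟨by simpa using hP.measure_outside_lt_top hr⟩

open Classical in
/-- The difference `P - N` as a set function on the Borel sets bounded away from zero. -/
def SignedAwayFromZero.ofMeasures (P N : Measure ℝ) (hP : IsLevyIntegrable P)
    (hN : IsLevyIntegrable N) : SignedAwayFromZero where
  toFun A := if A ∈ borelAwayFromZero then P.real A - N.real A else 0
  eq_zero_of_notMem A hA := if_neg hA
  empty := by simp
  iUnion r hr A hA hd := by
    have := isFiniteMeasure_restrict_outside hP hr
    have := isFiniteMeasure_restrict_outside hN hr
    let s := (P.restrict (outside r)).toSignedMeasure - (N.restrict (outside r)).toSignedMeasure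
    have hs : ∀ B ∈ borelAway r,
        (if B ∈ borelAwayFromZero then P.real B - N.real B else 0) = s B := by
      intro B hB
      rw [if_pos ⟨r, hr, hB⟩]
      simp only [s, Measure.toSignedMeasure_sub_apply hB.1, measureReal_restrict_apply hB.1,
        Set.inter_eq_left.2 (subset_outside hB)]
    have hU : (⋃ n, A n) ∈ borelAway r := by
      refine ⟨MeasurableSet.iUnion fun n => (hA n).1, ?_⟩
      rw [Set.iUnion_inter]
      simp [fun n => (hA n).2]
    rw [hs _ hU]
    simp only [fun n => hs _ (hA n)]
    exact s.m_iUnion (fun n => (hA n).1) hd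

/-- The Jordan decomposition is the minimal one. -/
theorem jordan_le_of_add_eq (J : JordanDecomposition ℝ) {P N : Measure ℝ}
    (h : P + J.negPart = N + J.posPart) : J.posPart ≤ P ∧ J.negPart ≤ N := by
  obtain ⟨S, hS, h1, h2⟩ := J.mutuallySingular
  constructor
  · refine Measure.le_iff.2 fun A hA => ?_
    calc J.posPart A = J.posPart (A ∩ Sᶜ) := by
          rw [← measure_inter_add_sdiff A hS, measure_mono_null Set.inter_subset_right h1, zero_add,
            Set.sdiff_eq]
      _ ≤ (N + J.posPart) (A ∩ Sᶜ) := by simp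
      _ = (P + J.negPart) (A ∩ Sᶜ) := by rw [h]
      _ = P (A ∩ Sᶜ) := by simp [measure_mono_null Set.inter_subset_right h2]
      _ ≤ P A := measure_mono Set.inter_subset_left
  · refine Measure.le_iff.2 fun A hA => ?_
    calc J.negPart A = J.negPart (A ∩ S) := by
          rw [← measure_inter_add_sdiff A hS, Set.sdiff_eq,
            measure_mono_null Set.inter_subset_right h2, add_zero]
      _ ≤ (P + J.negPart) (A ∩ S) := by simp
      _ = (N + J.posPart) (A ∩ S) := by rw [h]
      _ = N (A ∩ S) := by simp [measure_mono_null Set.inter_subset_right h1]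
      _ ≤ N A := measure_mono Set.inter_subset_left

open SignedAwayFromZero in
/-- Measures on `ℝ \ {0}` are compared on the Borel sets bounded away from zero. -/
theorem restrict_compl_zero_le {P Q : Measure ℝ}
    (h : ∀ r : ℝ, 0 < r → ∀ A ∈ borelAway r, P A ≤ Q A) :
    P.restrict {0}ᶜ ≤ Q.restrict {0}ᶜ := by
  refine Measure.le_iff.2 fun A hA => ?_
  have key (m : Measure ℝ) : m.restrict {0}ᶜ A = ∑' n, m (A ∩ annulus n) := by
    rw [Measure.restrict_apply hA, ← iUnion_annulus, Set.inter_iUnion, measure_iUnion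
      (fun i j hij => (annulus_disjoint hij).mono Set.inter_subset_right Set.inter_subset_right)
      (fun n => hA.inter (measurableSet_annulus n))]
  rw [key, key]
  refine ENNReal.tsum_le_tsum fun n => h (1 / ((n : ℝ) + 1)) (by positivity) _
    ⟨hA.inter (measurableSet_annulus n), ?_⟩
  rw [← Set.disjoint_iff_inter_eq_empty]
  exact Set.disjoint_left.2 fun x hx hx' => annulus_subset n hx.2 hx'

theorem integral_restrict_compl_zero (P : Measure ℝ) (z : ℝ) :
    ∫ x in {0}ᶜ, levyKernel z x ∂P = ∫ x, levyKernel z x ∂P :=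
  setIntegral_eq_integral_of_forall_compl_eq_zero fun x hx => by
    rw [Set.notMem_compl_iff.1 hx, levyKernel_zero_right]

theorem isLevyIntegrable_restrict_compl_zero {P : Measure ℝ} :
    IsLevyIntegrable (P.restrict {0}ᶜ) ↔ IsLevyIntegrable P := by
  have : ∫⁻ x in {0}ᶜ, ENNReal.ofReal (min 1 (x ^ 2)) ∂P =
      ∫⁻ x, ENNReal.ofReal (min 1 (x ^ 2)) ∂P := by
    conv_rhs => rw [← lintegral_add_compl _ (measurableSet_singleton (0 : ℝ)).compl, compl_compl,
      lintegral_singleton]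
    simp
  rw [IsLevyIntegrable, this, IsLevyIntegrable]

/-- The positive and negative parts of `P - N` satisfy `P + ν⁻ = N + ν⁺` on each `{x | r ≤ |x|}`. -/
theorem SignedAwayFromZero.jordan_ofMeasures {P N : Measure ℝ} (hP : IsLevyIntegrable P)
    (hN : IsLevyIntegrable N) {r : ℝ} (hr : 0 < r) :
    P.restrict (outside r) + ((ofMeasures P N hP hN).restr r hr).toJordanDecomposition.negPart =
      N.restrict (outside r) +
        ((ofMeasures P N hP hN).restr r hr).toJordanDecomposition.posPart := by
  have := isFiniteMeasure_restrict_outside hP hr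
  have := isFiniteMeasure_restrict_outside hN hr
  set s := (ofMeasures P N hP hN).restr r hr with hs
  have h1 : s = (P.restrict (outside r)).toSignedMeasure -
      (N.restrict (outside r)).toSignedMeasure := by
    ext A hA
    rw [hs, restr_apply _ hr hA, Measure.toSignedMeasure_sub_apply hA,
      measureReal_restrict_apply hA, measureReal_restrict_apply hA]
    exact if_pos ⟨r, hr, inter_outside_mem hA r⟩
  have h2 := SignedMeasure.toSignedMeasure_toJordanDecomposition s
  rw [JordanDecomposition.toSignedMeasure, h1, sub_eq_sub_iff_add_eq_add, ← h1] at h2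
  rw [← Measure.toSignedMeasure_eq_toSignedMeasure_iff, Measure.toSignedMeasure_add,
    Measure.toSignedMeasure_add, add_comm (N.restrict _).toSignedMeasure]
  exact h2.symm

/-- The quasi-Lévy type measure is `P - N`. Its positive and negative parts are dominated by `P` and
`N`, and `P + ν⁻ = N + ν⁺` off `0`, so that the integrals agree. -/
theorem isQuasiInfinitelyDivisible_of_isQuasiExponent {μ : Measure ℝ} {ψ : ℝ → ℂ}
    (hψ : IsQuasiExponent ψ) (hμ : ∀ z, charFun μ z = cexp (ψ z)) :
    IsQuasiInfinitelyDivisible μ := by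
  obtain ⟨a, γ, P, N, hP, hN, h⟩ := hψ
  set ν := SignedAwayFromZero.ofMeasures P N hP hN
  have hout (m : Measure ℝ) {r : ℝ} {A : Set ℝ} (hA : A ∈ borelAway r) :
      m.restrict (outside r) A = m A := by
    rw [Measure.restrict_apply hA.1, Set.inter_eq_left.2 (subset_outside hA)]
  have h1 : ν.posPart.restrict {0}ᶜ ≤ P.restrict {0}ᶜ := restrict_compl_zero_le fun r hr A hA => by
    rw [ν.posPart_apply hr hA, ← hout P hA]
    exact (jordan_le_of_add_eq _ (SignedAwayFromZero.jordan_ofMeasures hP hN hr)).1 A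
  have h2 : ν.negPart.restrict {0}ᶜ ≤ N.restrict {0}ᶜ := restrict_compl_zero_le fun r hr A hA => by
    rw [ν.negPart_apply hr hA, ← hout N hA]
    exact (jordan_le_of_add_eq _ (SignedAwayFromZero.jordan_ofMeasures hP hN hr)).2 A
  have h3 : ∀ r : ℝ, 0 < r → ∀ A ∈ borelAway r, (P + ν.negPart) A = (N + ν.posPart) A := by
    intro r hr A hA
    rw [Measure.add_apply, Measure.add_apply, ν.posPart_apply hr hA, ν.negPart_apply hr hA,
      ← hout P hA, ← hout N hA, ← Measure.add_apply, ← Measure.add_apply]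
    exact congrArg (fun m : Measure ℝ => m A) (SignedAwayFromZero.jordan_ofMeasures hP hN hr)
  have h4 : (P + ν.negPart).restrict {0}ᶜ = (N + ν.posPart).restrict {0}ᶜ :=
    le_antisymm (restrict_compl_zero_le fun r hr A hA => (h3 r hr A hA).le)
      (restrict_compl_zero_le fun r hr A hA => (h3 r hr A hA).ge)
  have hpos : IsLevyIntegrable ν.posPart := isLevyIntegrable_restrict_compl_zero.1
    ((isLevyIntegrable_restrict_compl_zero.2 hP).mono h1)
  have hneg : IsLevyIntegrable ν.negPart := isLevyIntegrable_restrict_compl_zero.1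
    ((isLevyIntegrable_restrict_compl_zero.2 hN).mono h2)
  refine ⟨a, γ, ν, hpos.add hneg, fun z => ?_⟩
  rw [hμ, h]
  congr 2
  have h5 : ∫ x, levyKernel z x ∂(P + ν.negPart) = ∫ x, levyKernel z x ∂(N + ν.posPart) := by
    rw [← integral_restrict_compl_zero, h4, integral_restrict_compl_zero]
  rw [integral_add_measure (hP.integrable_levyKernel z) (hneg.integrable_levyKernel z),
    integral_add_measure (hN.integrable_levyKernel z) (hpos.integrable_levyKernel z)] at h5
  rw [SignedAwayFromZero.integral]
  linear_combination h5

theorem IsQuasiInfinitelyDivisible.exists_isQuasiExponent {μ : Measure ℝ}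
    (h : IsQuasiInfinitelyDivisible μ) :
    ∃ ψ, IsQuasiExponent ψ ∧ ∀ z, charFun μ z = cexp (ψ z) := by
  obtain ⟨a, γ, ν, hν, h⟩ := h
  refine ⟨_, ⟨a, γ, ν.posPart, ν.negPart, ?_, ?_, fun z => rfl⟩, h⟩
  · exact IsLevyIntegrable.mono (Q := ν.totalVariation) hν (Measure.le_add_right le_rfl)
  · exact IsLevyIntegrable.mono (Q := ν.totalVariation) hν (Measure.le_add_left le_rfl)

/-! ### The exponent `2i arctan` -/

/-- The Lévy measure `e⁻ˣ / x dx` on `(0, ∞)` of the exponential distribution. -/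
def gammaLevy : Measure ℝ :=
  (volume.restrict (Set.Ioi 0)).withDensity fun x => ENNReal.ofReal (Real.exp (-x) / x)

theorem integrableOn_exp_neg : IntegrableOn (fun x : ℝ => Real.exp (-x)) (Set.Ioi 0) :=
  integrableOn_exp_neg_Ioi 0

theorem isLevyIntegrable_gammaLevy : IsLevyIntegrable gammaLevy := by
  rw [IsLevyIntegrable, gammaLevy, lintegral_withDensity_eq_lintegral_mul _ (by fun_prop)
    (by fun_prop)]
  refine lt_of_le_of_lt ?_ (integrableOn_exp_neg.lintegral_lt_top)
  refine setLIntegral_mono (by fun_prop) fun x (hx : 0 < x) => ?_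
  simp only [Pi.mul_apply]
  rw [← ENNReal.ofReal_mul (by positivity)]
  refine ENNReal.ofReal_le_ofReal ?_
  have : min 1 (x ^ 2) ≤ x := by
    rcases le_total x 1 with h | h
    · exact (min_le_right _ _).trans (by nlinarith)
    · exact (min_le_left _ _).trans h
  calc Real.exp (-x) / x * min 1 (x ^ 2) ≤ Real.exp (-x) / x * x := by gcongr
    _ = Real.exp (-x) := by field_simp

theorem integral_cos_mul_exp_neg (z : ℝ) :
    ∫ x in Set.Ioi (0 : ℝ), Real.cos (x * z) * Real.exp (-x) = 1 / (1 + z ^ 2) := by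
  have hre : (-(1 - z * I) : ℂ).re < 0 := by simp
  have h1 := integral_exp_mul_complex_Ioi hre 0
  have hi := integrableOn_exp_mul_complex_Ioi hre 0
  have h2 := integral_re hi
  rw [RCLike.re_eq_complex_re, h1] at h2
  have h3 : ∀ x : ℝ, (cexp (-(1 - z * I) * x)).re = Real.cos (x * z) * Real.exp (-x) := by
    intro x
    rw [Complex.exp_re]
    simp
    ring_nf
  simp only [h3] at h2
  rw [h2, ofReal_zero, mul_zero, Complex.exp_zero, neg_div_neg_eq, one_div, Complex.inv_re]
  simp [Complex.normSq_apply]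
  ring

theorem integrableOn_sin_mul_exp_neg_div (z : ℝ) :
    IntegrableOn (fun x : ℝ => Real.sin (x * z) * (Real.exp (-x) / x)) (Set.Ioi 0) := by
  refine (integrableOn_exp_neg.const_mul |z|).mono' (Measurable.aestronglyMeasurable
    (by fun_prop)) ?_
  refine ae_restrict_of_forall_mem measurableSet_Ioi fun x (hx : 0 < x) => ?_
  have h0 : 0 ≤ Real.exp (-x) / x := by positivity
  rw [norm_mul, Real.norm_eq_abs, Real.norm_eq_abs, abs_of_nonneg h0]
  have h1 : |Real.sin (x * z)| ≤ x * |z| := by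
    refine Real.abs_sin_le_abs.trans ?_
    rw [abs_mul, abs_of_pos hx]
  calc |Real.sin (x * z)| * (Real.exp (-x) / x) ≤ x * |z| * (Real.exp (-x) / x) := by gcongr
    _ = |z| * Real.exp (-x) := by field_simp

/-- Both sides vanish at `0` and have the derivative `1 / (1 + z²)`. -/
theorem integral_sin_mul_exp_neg_div (z : ℝ) :
    ∫ x in Set.Ioi (0 : ℝ), Real.sin (x * z) * (Real.exp (-x) / x) = Real.arctan z := by
  let G : ℝ → ℝ := fun z => ∫ x in Set.Ioi (0 : ℝ), Real.sin (x * z) * (Real.exp (-x) / x)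
  have hG : ∀ z, HasDerivAt G (1 / (1 + z ^ 2)) z := by
    intro z
    rw [← integral_cos_mul_exp_neg z]
    refine (hasDerivAt_integral_of_dominated_loc_of_deriv_le (s := Set.univ) univ_mem
      (F := fun z x => Real.sin (x * z) * (Real.exp (-x) / x))
      (F' := fun z x => Real.cos (x * z) * Real.exp (-x))
      (bound := fun x => Real.exp (-x)) ?_ ?_ ?_ ?_ integrableOn_exp_neg ?_).2
    · refine Eventually.of_forall fun z => Measurable.aestronglyMeasurable (by fun_prop)
    · exact integrableOn_sin_mul_exp_neg_div z
    · exact Measurable.aestronglyMeasurable (by fun_prop)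
    · refine Eventually.of_forall fun x z _ => ?_
      rw [norm_mul, Real.norm_eq_abs, Real.norm_eq_abs, Real.abs_exp]
      exact mul_le_of_le_one_left (Real.exp_pos _).le (Real.abs_cos_le_one _)
    · refine ae_restrict_of_forall_mem measurableSet_Ioi fun x (hx : 0 < x) z _ => ?_
      have h1 : HasDerivAt (fun z => Real.sin (x * z)) (Real.cos (x * z) * x) z := by
        simpa using ((hasDerivAt_id z).const_mul x).sin
      rw [show Real.cos (x * z) * Real.exp (-x) = Real.cos (x * z) * x * (Real.exp (-x) / x) by
        field_simp]
      exact h1.mul_const _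
  have hd : ∀ z, HasDerivAt (fun z => G z - Real.arctan z) 0 z := by
    intro z
    simpa using! (hG z).sub (Real.hasDerivAt_arctan z)
  have hc := is_const_of_deriv_eq_zero (fun z => (hd z).differentiableAt)
    (fun z => (hd z).deriv) z 0
  have h0 : G 0 = 0 := by simp [G]
  rw [h0, Real.arctan_zero, sub_zero] at hc
  exact sub_eq_zero.1 hc

/-- The function `2i arctan` is the difference of the exponents of the exponential distribution and
of its reflection, with characteristic functions `1 / (1 - iz)` and `1 / (1 + iz)`. -/
theorem isQuasiExponent_two_arctan : IsQuasiExponent fun z => 2 * I * Real.arctan z := by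
  let c : ℝ → ℝ := (Set.Icc (-1 : ℝ) 1).indicator fun _ => 1
  have hc : ∀ x, c (-x) = c x := by
    intro x
    have : -x ∈ Set.Icc (-1 : ℝ) 1 ↔ x ∈ Set.Icc (-1 : ℝ) 1 := by
      simp only [Set.mem_Icc]; constructor <;> rintro ⟨h1, h2⟩ <;> constructor <;> linarith
    by_cases hx : x ∈ Set.Icc (-1 : ℝ) 1
    · simp only [c, Set.indicator_of_mem hx, Set.indicator_of_mem (this.2 hx)]
    · simp only [c, Set.indicator_of_notMem hx, Set.indicator_of_notMem (mt this.1 hx)]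
  have hneg : IsLevyIntegrable (gammaLevy.map Neg.neg) := by
    rw [IsLevyIntegrable, lintegral_map (by fun_prop) measurable_neg]
    simpa [IsLevyIntegrable] using isLevyIntegrable_gammaLevy
  have hsin : IntegrableOn (fun x : ℝ => Real.exp (-x) * c x) (Set.Ioi 0) := by
    refine integrableOn_exp_neg.mono' ((Measurable.mul (by fun_prop)
      (measurable_const.indicator measurableSet_Icc)).aestronglyMeasurable)
      (Eventually.of_forall fun x => ?_)
    by_cases hx : x ∈ Set.Icc (-1 : ℝ) 1 <;> simp [c, hx, Real.exp_nonneg]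
  -- The linear term makes up for the compensator of the kernel.
  refine ⟨0, 2 * ∫ x in Set.Ioi (0 : ℝ), Real.exp (-x) * c x, gammaLevy, gammaLevy.map Neg.neg,
    isLevyIntegrable_gammaLevy, hneg, fun z => ?_⟩
  have hk : ∀ x, levyKernel z x - levyKernel z (-x) =
      2 * I * ((Real.sin (x * z) - x * z * c x : ℝ) : ℂ) := by
    intro x
    have hcx : ∀ x, (Set.Icc (-1 : ℝ) 1).indicator (fun _ => (1 : ℂ)) x = (c x : ℂ) := by
      intro x
      by_cases hx : x ∈ Set.Icc (-1 : ℝ) 1 <;> simp [c, hx]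
    rw [levyKernel, levyKernel, hcx, hcx, hc]
    push_cast
    rw [Complex.sin, show -((x : ℂ) * z) * I = I * -x * z by ring,
      show (x : ℂ) * z * I = I * x * z by ring]
    linear_combination (cexp (I * x * z) - cexp (I * -x * z)) * I_sq
  rw [integral_map measurable_neg.aemeasurable (measurable_levyKernel z).aestronglyMeasurable,
    ← integral_sub (isLevyIntegrable_gammaLevy.integrable_levyKernel z)]
  · simp only [hk]
    rw [integral_const_mul, integral_complex_ofReal, gammaLevy,
      integral_withDensity_eq_integral_toReal_smul (by fun_prop) (by simp)]
    have h1 : ∀ x ∈ Set.Ioi (0 : ℝ), (ENNReal.ofReal (Real.exp (-x) / x)).toReal •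
        (Real.sin (x * z) - x * z * c x) =
        Real.sin (x * z) * (Real.exp (-x) / x) - z * (Real.exp (-x) * c x) := by
      intro x hx
      have hx : 0 < x := hx
      rw [ENNReal.toReal_ofReal (by positivity), smul_eq_mul]
      field_simp
    rw [setIntegral_congr_fun measurableSet_Ioi h1, integral_sub, integral_const_mul,
      integral_sin_mul_exp_neg_div]
    · push_cast
      ring
    · exact integrableOn_sin_mul_exp_neg_div z
    · exact hsin.const_mul z
  · have := hneg.integrable_levyKernel z
    exact (integrable_map_measure (measurable_levyKernel z).aestronglyMeasurable
      measurable_neg.aemeasurable).1 this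

/-! ### Quasi-infinite divisibility from zero-free characteristic functions -/

/-- The part `∫ e^{izx} f(w) dρ(x, w)` of a Fourier transform, for a real function `f` with
`|f w| ≤ ‖w‖`, is a difference of characteristic functions of finite measures. -/
theorem exists_charFun_sub {ρ : Measure (ℝ × ℂ)} (hρ : ∫⁻ p, ‖p.2‖ₑ ∂ρ < ⊤) {f : ℂ → ℝ}
    (hf : Measurable f) (hfle : ∀ w, |f w| ≤ ‖w‖) :
    ∃ P N : Measure ℝ, IsFiniteMeasure P ∧ IsFiniteMeasure N ∧ ∀ z : ℝ,
      ∫ p, cexp (z * p.1 * I) * f p.2 ∂ρ = charFun P z - charFun N z := by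
  have key : ∀ g : ℂ → ℝ, Measurable g → (∀ w, g w ≤ ‖w‖) → ∃ P : Measure ℝ, IsFiniteMeasure P ∧
      ∀ z : ℝ, charFun P z = ∫ p, cexp (z * p.1 * I) * (max (g p.2) 0 : ℝ) ∂ρ := by
    intro g hg hgle
    have hgm : Measurable fun p : ℝ × ℂ => ENNReal.ofReal (g p.2) := by fun_prop
    have hfin : IsFiniteMeasure (ρ.withDensity fun p => ENNReal.ofReal (g p.2)) := by
      refine isFiniteMeasure_withDensity ((lintegral_mono fun p => ?_).trans_lt hρ).ne
      rw [← ofReal_norm]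
      exact ENNReal.ofReal_le_ofReal (hgle _)
    refine ⟨(ρ.withDensity fun p => ENNReal.ofReal (g p.2)).map Prod.fst, inferInstance,
      fun z => ?_⟩
    rw [charFun_apply_real, integral_map (by fun_prop) (by fun_prop),
      integral_withDensity_eq_integral_toReal_smul hgm (by simp)]
    refine integral_congr_ae (Eventually.of_forall fun p => ?_)
    simp only [ENNReal.toReal_ofReal', real_smul]
    ring
  obtain ⟨P, hP, hP'⟩ := key f hf fun w => (le_abs_self _).trans (hfle w)
  obtain ⟨N, hN, hN'⟩ := key (fun w => -f w) hf.neg fun w => (neg_le_abs _).trans (hfle w)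
  refine ⟨P, N, hP, hN, fun z => ?_⟩
  have hint : ∀ g : ℂ → ℝ, Measurable g → (∀ w, |g w| ≤ ‖w‖) →
      Integrable (fun p : ℝ × ℂ => cexp (z * p.1 * I) * (max (g p.2) 0 : ℝ)) ρ := by
    intro g hg hgle
    refine (integrable_cexp_mul hρ z).mono (by fun_prop) (Eventually.of_forall fun p => ?_)
    rw [norm_mul, norm_mul]
    gcongr
    rw [norm_real, Real.norm_eq_abs, abs_of_nonneg (le_max_right _ _)]
    exact max_le ((le_abs_self _).trans (hgle _)) (norm_nonneg _)
  rw [hP', hN', ← integral_sub (hint f hf hfle) (hint (fun w => -f w) hf.neg (by simpa using hfle))]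
  refine integral_congr_ae (Eventually.of_forall fun p => ?_)
  simp only
  rw [← mul_sub, ← ofReal_sub, max_zero_sub_max_neg_zero_eq_self]

theorem HasFourierRep.exists_measures {G : AddSubgroup ℝ} {R : ℝ → ℂ} {C : ℝ≥0}
    (hR : HasFourierRep G R C) : ∃ P N P' N' : Measure ℝ, IsFiniteMeasure P ∧ IsFiniteMeasure N ∧
      IsFiniteMeasure P' ∧ IsFiniteMeasure N' ∧ ∀ z : ℝ,
        R z = (MeasureTheory.charFun P z - MeasureTheory.charFun N z) +
          I * (MeasureTheory.charFun P' z - MeasureTheory.charFun N' z) := by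
  obtain ⟨-, ρ, -, -, h3, h4⟩ := hR
  have hρ := h3.trans_lt ENNReal.coe_lt_top
  obtain ⟨P, N, hP, hN, h⟩ := exists_charFun_sub hρ measurable_re abs_re_le_norm
  obtain ⟨P', N', hP', hN', h'⟩ := exists_charFun_sub hρ measurable_im abs_im_le_norm
  refine ⟨P, N, P', N', hP, hN, hP', hN', fun z => ?_⟩
  have hint : ∀ f : ℂ → ℝ, Measurable f → (∀ w, |f w| ≤ ‖w‖) →
      Integrable (fun p : ℝ × ℂ => cexp (z * p.1 * I) * f p.2) ρ := by
    intro g hg hgle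
    refine (integrable_cexp_mul hρ z).mono (by fun_prop) (Eventually.of_forall fun p => ?_)
    rw [norm_mul, norm_mul]
    gcongr
    simpa using hgle p.2
  rw [h4, ← h, ← h', ← integral_const_mul, ← integral_add (hint _ measurable_re abs_re_le_norm)
    ((hint _ measurable_im abs_im_le_norm).const_mul I)]
  refine integral_congr_ae (Eventually.of_forall fun p => ?_)
  simp only
  conv_lhs => rw [← re_add_im p.2]
  ring

theorem continuous_charFun_of_isFiniteMeasure (P : Measure ℝ) [IsFiniteMeasure P] :
    Continuous (charFun P) :=
  (HasFourierRep.charFun (G := ⊤) MeasurableSet.univ (m := P) (by simp)).continuous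

/-- A probability measure whose lattice part and itself have zero-free characteristic functions is
quasi-infinitely divisible. -/
theorem isQuasiInfinitelyDivisible_of_ne_zero {μ md ma : Measure ℝ} [IsProbabilityMeasure μ]
    (hμ : μ = md + ma) {r h : ℝ} (hh : 0 < h) (hd : ∀ᵐ x ∂md, x ∈ lattice r h) (ha : ma ≪ volume)
    (h0 : ∀ z, charFun md z ≠ 0) (h1 : ∀ z, charFun μ z ≠ 0) :
    IsQuasiInfinitelyDivisible μ := by
  have : IsFiniteMeasure md := isFiniteMeasure_of_le μ (hμ ▸ Measure.le_add_right le_rfl)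
  have : IsFiniteMeasure ma := isFiniteMeasure_of_le μ (hμ ▸ Measure.le_add_left le_rfl)
  obtain ⟨γ, n, R, C, hR, hexp⟩ := exists_charFun_eq_exp hh hd ha h0 (hμ ▸ h1)
  rw [← hμ] at hexp
  obtain ⟨P, N, P', N', _, _, _, _, hRz⟩ := hR.exists_measures
  set ψ : ℝ → ℂ := fun z => (I * γ * z + n * (2 * I * Real.arctan z)) +
    ((charFun P z - charFun P 0) + -(charFun N z - charFun N 0)) with hψ
  have hψQ : IsQuasiExponent ψ :=
    ((IsQuasiExponent.linear γ).add (isQuasiExponent_two_arctan.int_mul n)).add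
      ((IsQuasiExponent.charFun_sub P).add (IsQuasiExponent.charFun_sub N).neg)
  set A₀ := charFun P 0 - charFun N 0 with hA₀
  set B : ℝ → ℂ := fun z => charFun P' z - charFun N' z with hB
  have hBconj : ∀ z, (starRingEnd ℂ) (B (-z)) = B z := by
    intro z
    simp [hB, charFun_neg]
  have hA₀conj : (starRingEnd ℂ) A₀ = A₀ := by
    simp [hA₀]
  have hμψ : ∀ z, charFun μ z = cexp (ψ z + A₀ + I * B z) := by
    intro z
    rw [hexp, hRz]
    congr 1
    simp only [hψ, hA₀, hB]
    ring
  -- The hermitian symmetry of `charFun μ` forces the contribution of `B` to be constant.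
  have hμψ' : ∀ z, charFun μ z = cexp (ψ z + A₀ - I * B z) := by
    intro z
    rw [← neg_neg z, charFun_neg, hμψ, ← Complex.exp_conj, map_add, map_add, map_mul,
      hψQ.conj_neg, hBconj, hA₀conj, conj_I, neg_neg]
    congr 1
    ring
  have hBc : Continuous B :=
    (continuous_charFun_of_isFiniteMeasure P').sub (continuous_charFun_of_isFiniteMeasure N')
  obtain ⟨k, hk⟩ := exists_int_of_exp_eq_one (S := Set.univ) isPreconnected_univ
    (f := fun z => (ψ z + A₀ + I * B z) - (ψ z + A₀ - I * B z)) (by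
      have : (fun z => (ψ z + A₀ + I * B z) - (ψ z + A₀ - I * B z)) = fun z => 2 * I * B z := by
        ext z; ring
      rw [this]
      fun_prop) (fun z _ => by
      rw [Complex.exp_sub, ← hμψ, ← hμψ', div_self (h1 z)])
  have hconst : ∀ z, I * B z = I * B 0 := by
    intro z
    have e1 := hk z trivial
    have e2 := hk 0 trivial
    linear_combination (e1 - e2) / 2
  have hone : cexp (A₀ + I * B 0) = 1 := by
    have := hμψ 0
    rw [hψQ.apply_zero, zero_add] at this
    rw [← this]
    simp
  refine isQuasiInfinitelyDivisible_of_isQuasiExponent hψQ fun z => ?_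
  rw [hμψ, hconst, add_assoc, Complex.exp_add, hone, mul_one]

/-! ### The convolution factors inherit the structure -/

theorem countable_lattice (r h : ℝ) : (lattice r h).Countable := Set.countable_range _

theorem measurableSet_lattice (r h : ℝ) : MeasurableSet (lattice r h) :=
  (countable_lattice r h).measurableSet

theorem mul_le_conv {μ₁ μ₂ : Measure ℝ} [SFinite μ₁] [SFinite μ₂] {A E : Set ℝ} {y : ℝ}
    (hE : MeasurableSet E) (hAE : ∀ x ∈ A, x + y ∈ E) :
    μ₁ A * μ₂ {y} ≤ (Measure.conv μ₁ μ₂) E := by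
  rw [Measure.conv, Measure.map_apply (by fun_prop) hE, ← Measure.prod_prod]
  refine measure_mono ?_
  rintro ⟨x, y'⟩ ⟨hx, hy⟩
  obtain rfl : y' = y := hy
  exact hAE x hx

theorem exists_atom_right_of_conv {μ₁ μ₂ : Measure ℝ} [SFinite μ₁] [SFinite μ₂] {z : ℝ}
    (hz : (Measure.conv μ₁ μ₂) {z} ≠ 0) : ∃ y, μ₂ {y} ≠ 0 := by
  by_contra! h
  refine hz ?_
  rw [← lintegral_indicator_one (measurableSet_singleton z),
    Measure.lintegral_conv (measurable_one.indicator (measurableSet_singleton z))]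
  refine lintegral_eq_zero_of_ae_eq_zero (Eventually.of_forall fun x => ?_)
  have : (fun y => ({z} : Set ℝ).indicator (1 : ℝ → ℝ≥0∞) (x + y)) =
      ({z - x} : Set ℝ).indicator 1 := by
    ext y
    by_cases hy : y = z - x
    · simp [hy]
    · have : x + y ≠ z := fun h => hy (by linarith)
      simp [hy, this]
  simp only [this, lintegral_indicator_one (measurableSet_singleton _), h, Pi.zero_apply]

/-- If `μ₂` has an atom at `y`, then a translate of `μ₁` by `y` is bounded by a multiple of
`μ₁ ∗ μ₂`, so the part of `μ₁` off the translated lattice is absolutely continuous. -/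
theorem restrict_compl_absolutelyContinuous {μ₁ μ₂ : Measure ℝ} [SFinite μ₁] [SFinite μ₂]
    {r h y : ℝ} (hy : μ₂ {y} ≠ 0)
    (hμ : ∀ E : Set ℝ, MeasurableSet E → volume E = 0 → E ⊆ (lattice r h)ᶜ →
      (Measure.conv μ₁ μ₂) E = 0) :
    μ₁.restrict (lattice (r - y) h)ᶜ ≪ volume := by
  refine Measure.AbsolutelyContinuous.mk fun A hA hA0 => ?_
  rw [Measure.restrict_apply hA]
  have hB := hA.inter (measurableSet_lattice (r - y) h).compl
  have hE : MeasurableSet ((fun x => x - y) ⁻¹' (A ∩ (lattice (r - y) h)ᶜ)) :=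
    (measurable_sub_const y) hB
  have h1 := mul_le_conv (μ₁ := μ₁) (μ₂ := μ₂) (A := A ∩ (lattice (r - y) h)ᶜ) (y := y) hE
    (fun x hx => by simpa using hx)
  rw [hμ _ hE ?_ ?_] at h1
  · exact (mul_eq_zero.1 (le_antisymm h1 zero_le)).resolve_right hy
  · rw [(measurePreserving_sub_right volume y).measure_preimage hB.nullMeasurableSet]
    exact measure_mono_null Set.inter_subset_left hA0
  · rintro x ⟨-, hx⟩ ⟨k, rfl⟩
    exact hx ⟨k, by ring⟩

theorem eq_of_add_eq_add_of_null {a b a' b' : Measure ℝ} {L : Set ℝ} (h : a + b = a' + b')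
    (ha : a Lᶜ = 0) (ha' : a' Lᶜ = 0) (hb : b L = 0)
    (hb' : b' L = 0) : a = a' := by
  have key : ∀ {c d : Measure ℝ}, c Lᶜ = 0 → d L = 0 → (c + d).restrict L = c := by
    intro c d hc hd
    rw [Measure.restrict_add, Measure.restrict_eq_zero.2 hd, add_zero]
    exact Measure.restrict_eq_self_of_ae_mem hc
  rw [← key ha hb, h, key ha' hb']

/-- The lattice parts of the factors convolve to the lattice part of `μ`, so that their
characteristic functions are zero-free as well. -/
theorem exists_factor_decomposition {μ μ₁ μ₂ md ma : Measure ℝ} [IsProbabilityMeasure μ]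
    [IsProbabilityMeasure μ₁] [IsProbabilityMeasure μ₂] (hμ : μ = md + ma) {r h : ℝ}
    (hd : md (lattice r h)ᶜ = 0) (ha : ma ≪ volume) (h0 : ∀ z, charFun md z ≠ 0)
    (hfactor : μ = Measure.conv μ₁ μ₂) :
    ∃ r₁ r₂ : ℝ, μ₁.restrict (lattice r₁ h)ᶜ ≪ volume ∧ μ₂.restrict (lattice r₂ h)ᶜ ≪ volume ∧
      ∀ z, charFun md z =
        charFun (μ₁.restrict (lattice r₁ h)) z * charFun (μ₂.restrict (lattice r₂ h)) z := by
  have hL := measurableSet_lattice r h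
  have hLnull : ∀ r, (volume : Measure ℝ) (lattice r h) = 0 :=
    fun r => (countable_lattice r h).measure_zero _
  have hnull : ∀ E : Set ℝ, MeasurableSet E → volume E = 0 → E ⊆ (lattice r h)ᶜ →
      (Measure.conv μ₁ μ₂) E = 0 := by
    intro E _ hE0 hE
    rw [← hfactor, hμ, Measure.add_apply, ha hE0, add_zero]
    exact measure_mono_null hE hd
  obtain ⟨z, hz⟩ : ∃ z, (Measure.conv μ₁ μ₂) {z} ≠ 0 := by
    by_contra! hno
    have h1 : μ (lattice r h) = 0 := by
      rw [hfactor, ← Set.biUnion_of_singleton (lattice r h)]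
      exact (measure_biUnion_null_iff (countable_lattice r h)).2 fun x _ => hno x
    have h2 : md = 0 := by
      rw [← Measure.measure_univ_eq_zero, ← measure_add_measure_compl hL, hd, add_zero]
      rw [hμ, Measure.add_apply] at h1
      exact (add_eq_zero.1 h1).1
    exact h0 0 (by simp [h2])
  obtain ⟨y, hy⟩ := exists_atom_right_of_conv hz
  rw [Measure.conv_comm] at hz
  obtain ⟨x, hx⟩ := exists_atom_right_of_conv hz
  obtain ⟨j, hj⟩ : x + y ∈ lattice r h := by
    by_contra hxy
    have h1 := mul_le_conv (μ₁ := μ₁) (μ₂ := μ₂) (A := {x}) (y := y)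
      (measurableSet_singleton (x + y)) (by simp)
    rw [hnull _ (measurableSet_singleton _) (by simp) (by simpa using hxy)] at h1
    exact (mul_ne_zero hx hy) (le_antisymm h1 zero_le)
  have hac₁ := restrict_compl_absolutelyContinuous hy hnull
  have hac₂ := restrict_compl_absolutelyContinuous (μ₁ := μ₂) (μ₂ := μ₁) hx
    (by rwa [Measure.conv_comm] at hnull)
  refine ⟨r - y, r - x, hac₁, hac₂, fun z => ?_⟩
  rw [← charFun_conv]
  congr 1
  have hL₁ := measurableSet_lattice (r - y) h
  have hL₂ := measurableSet_lattice (r - x) h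
  set a₁ := μ₁.restrict (lattice (r - y) h)
  set b₁ := μ₁.restrict (lattice (r - y) h)ᶜ
  set a₂ := μ₂.restrict (lattice (r - x) h)
  set b₂ := μ₂.restrict (lattice (r - x) h)ᶜ
  have hsum : md + ma = Measure.conv a₁ a₂ + (Measure.conv a₁ b₂ + Measure.conv b₁ μ₂) := by
    rw [← hμ, hfactor, ← add_assoc, ← Measure.conv_add, Measure.restrict_add_restrict_compl hL₂,
      ← Measure.add_conv, Measure.restrict_add_restrict_compl hL₁]
  refine eq_of_add_eq_add_of_null hsum hd ?_ (ha (hLnull r)) ?_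
  · change ∀ᵐ x ∂(Measure.conv a₁ a₂), x ∈ lattice r h
    refine (ae_map_iff (by fun_prop) hL).2 ?_
    filter_upwards [Measure.quasiMeasurePreserving_fst.ae (ae_restrict_mem hL₁),
      Measure.quasiMeasurePreserving_snd.ae (ae_restrict_mem hL₂)] with p hp hq
    obtain ⟨k, hk⟩ := hp
    obtain ⟨l, hl⟩ := hq
    refine ⟨k + l - j, ?_⟩
    simp only at hj hk hl ⊢
    rw [← hk, ← hl]
    push_cast
    linear_combination -hj
  · have h1 : Measure.conv a₁ b₂ ≪ volume := Measure.conv_absolutelyContinuous hac₂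
    have h2 : Measure.conv b₁ μ₂ ≪ volume := by
      rw [Measure.conv_comm]
      exact Measure.conv_absolutelyContinuous hac₁
    rw [Measure.add_apply, h1 (hLnull r), h2 (hLnull r), add_zero]

end QuasiID

end

theorem mainTheorem10
    (μ μ₁ μ₂ : Measure ℝ) [IsProbabilityMeasure μ] [IsProbabilityMeasure μ₁]
    [IsProbabilityMeasure μ₂]
    (μd : Measure ℝ) (r h : ℝ) (hh : 0 < h)
    (hlattice : μd (QuasiID.lattice r h)ᶜ = 0)
    (f : ℝ → ℝ) (hf : Measurable f) (hf0 : ∀ x, 0 ≤ f x) (hfint : Integrable f volume)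
    (hμ : μ = μd + volume.withDensity (fun x => ENNReal.ofReal (f x)))
    (hnonvanishing : ∀ z : ℝ, charFun μd z ≠ 0)
    (hfactor : μ = Measure.conv μ₁ μ₂) :
    QuasiID.IsQuasiInfinitelyDivisible μ ↔
      QuasiID.IsQuasiInfinitelyDivisible μ₁ ∧ QuasiID.IsQuasiInfinitelyDivisible μ₂ := by
  have hchar : ∀ z, charFun μ z = charFun μ₁ z * charFun μ₂ z := fun z => by
    rw [hfactor, charFun_conv]
  constructor
  · intro hq
    obtain ⟨ψ, -, hψ⟩ := hq.exists_isQuasiExponent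
    have hne : ∀ z, charFun μ₁ z * charFun μ₂ z ≠ 0 := fun z => by
      rw [← hchar, hψ]
      exact Complex.exp_ne_zero _
    obtain ⟨r₁, r₂, hac₁, hac₂, hprod⟩ := QuasiID.exists_factor_decomposition hμ hlattice
      (withDensity_absolutelyContinuous _ _) hnonvanishing hfactor
    have hd : ∀ z, charFun (μ₁.restrict (QuasiID.lattice r₁ h)) z *
        charFun (μ₂.restrict (QuasiID.lattice r₂ h)) z ≠ 0 := fun z => by
      rw [← hprod]
      exact hnonvanishing z
    exact ⟨QuasiID.isQuasiInfinitelyDivisible_of_ne_zero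
        (Measure.restrict_add_restrict_compl (QuasiID.measurableSet_lattice r₁ h)).symm hh
        (ae_restrict_mem (QuasiID.measurableSet_lattice r₁ h)) hac₁
        (fun z => left_ne_zero_of_mul (hd z)) (fun z => left_ne_zero_of_mul (hne z)),
      QuasiID.isQuasiInfinitelyDivisible_of_ne_zero
        (Measure.restrict_add_restrict_compl (QuasiID.measurableSet_lattice r₂ h)).symm hh
        (ae_restrict_mem (QuasiID.measurableSet_lattice r₂ h)) hac₂
        (fun z => right_ne_zero_of_mul (hd z)) (fun z => right_ne_zero_of_mul (hne z))⟩
  · rintro ⟨h₁, h₂⟩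
    obtain ⟨ψ₁, hψ₁, h₁⟩ := h₁.exists_isQuasiExponent
    obtain ⟨ψ₂, hψ₂, h₂⟩ := h₂.exists_isQuasiExponent
    refine QuasiID.isQuasiInfinitelyDivisible_of_isQuasiExponent (hψ₁.add hψ₂) fun z => ?_
    rw [hchar, h₁, h₂, Complex.exp_add]
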